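/- Let $n\ge 1$ and equip $\mathbb R^{2n+1}$, with coordinates $(x_1,\dots,x_n,y_1,\dots,y_n,z)$, with the standard contact structure $\xi=\ker\alpha$, $\alpha=dz+\sum_{i=1}^n x_i\,dy_i$, cooriented by $\alpha$. A path of diffeomorphisms is a family $(f_t)_{t\in[0,1]}$ of $C^\infty$-diffeomorphisms of $\mathbb R^{2n+1}$ such that $(t,p)\mapsto f_t(p)$ is smooth on $[0,1]\times\mathbb R^{2n+1}$; it joins $f_0$ to $f_1$. It is null if $\alpha_{f_t(p)}\big(\tfrac{\partial}{\partial t}f_t(p)\big)=0$ for all $t\in[0,1]$ and $p\in\mathbb R^{2n+1}$, positive if $\alpha_{f_t(p)}\big(\tfrac{\partial}{\partial t}f_t(p)\big)>0$ for all $t$ and $p$, and compactly supported if there is a compact set outside of which every $f_t$ is the identity. Let $\mathrm{Diff}_0(\mathbb R^{2n+1})$ be the set of diffeomorphisms that are joined to $\mathrm{id}$ by a path of diffeomorphisms. (1) Every $f\in\mathrm{Diff}_0(\mathbb R^{2n+1})$ is joined to $\mathrm{id}$ by a null path $(g_t)$ and by a positive path $(h_t)$ of diffeomorphisms, $g_0=h_0=\mathrm{id}$,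 $g_1=h_1=f$. (2) If $f$ is joined to $\mathrm{id}$ by a compactly supported path of diffeomorphisms, then it is joined to $\mathrm{id}$ by a compactly supported null path (from $\mathrm{id}$ to $f$), and by positive paths that are arbitrarily close to $\mathrm{id}$ in the $C^\infty$-compact-open topology outside of a compact set: there is a compact set $K\subset\mathbb R^{2n+1}$ such that for every $r\in\mathbb N$, every compact $L\subset\mathbb R^{2n+1}$ and every $\varepsilon>0$ there is a positive path $(h_t)_{t\in[0,1]}$ with $h_0=\mathrm{id}$, $h_1=f$ and $$\|D^k(h_t-\mathrm{id})(p)\|<\varepsilon\qquad\text{for all } t\in[0,1],\ 0\le k\le r,\ p\in L\setminus K .$$ -/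

import Mathlib

open Set
open scoped Manifold ContDiff

/-- The space `ℝ^{2n+1}` with coordinates `(x, y, z)`, where `x, y ∈ ℝⁿ` and `z ∈ ℝ`. -/
abbrev StdSpace (n : ℕ) : Type := (Fin n → ℝ) × (Fin n → ℝ) × ℝ

/-- The standard contact form `α = dz + ∑ᵢ xᵢ dyᵢ` at the point `p`. -/
noncomputable def stdContactForm (n : ℕ) (p : StdSpace n) : StdSpace n →L[ℝ] ℝ :=
  (ContinuousLinearMap.snd ℝ (Fin n → ℝ) ℝ).comp
      (ContinuousLinearMap.snd ℝ (Fin n → ℝ) ((Fin n → ℝ) × ℝ)) +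
    ∑ i : Fin n, p.1 i •
      (ContinuousLinearMap.proj (R := ℝ) (φ := fun _ : Fin n => ℝ) i).comp
        ((ContinuousLinearMap.fst ℝ (Fin n → ℝ) ℝ).comp
          (ContinuousLinearMap.snd ℝ (Fin n → ℝ) ((Fin n → ℝ) × ℝ)))

theorem stdContactForm_apply (n : ℕ) (p v : StdSpace n) :
    stdContactForm n p v = v.2.2 + ∑ i : Fin n, p.1 i * v.2.1 i := by
  simp [stdContactForm]

/-- The standard contact structure `ξ = ker α` at the point `p`. -/
noncomputable def stdContactStructure (n : ℕ) (p : StdSpace n) : Submodule ℝ (StdSpace n) :=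
  LinearMap.ker (stdContactForm n p).toLinearMap

/-- The `C^∞`-diffeomorphisms of `ℝ^{2n+1}`. -/
abbrev StdDiffeo (n : ℕ) : Type :=
  Diffeomorph 𝓘(ℝ, StdSpace n) 𝓘(ℝ, StdSpace n) (StdSpace n) (StdSpace n) ∞

/-- `F` is a smooth path of diffeomorphisms, parametrized by `[0, 1]`, from the identity to `f`:
the map `(t, p) ↦ F t p` is smooth on `[0, 1] × ℝ^{2n+1}`. The values of `F` at parameters outside
`[0, 1]` play no role. -/
def IsDiffeoPathTo {n : ℕ} (F : ℝ → StdDiffeo n) (f : StdDiffeo n) : Prop :=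
  ContDiffOn ℝ ∞ (fun q : ℝ × StdSpace n => F q.1 q.2) (Icc (0 : ℝ) 1 ×ˢ univ) ∧
    (∀ p, F 0 p = p) ∧ (∀ p, F 1 p = f p)

/-- The identity component `Diff₀(ℝ^{2n+1})`: the diffeomorphisms that are connected to the identity
by a smooth path of diffeomorphisms. -/
def diffZero (n : ℕ) : Set (StdDiffeo n) :=
  {f | ∃ F : ℝ → StdDiffeo n, IsDiffeoPathTo F f}

/-- The velocity at time `t ∈ [0, 1]` of the curve `s ↦ F s p` (one-sided at the end points); it is
a tangent vector at the point `F t p`. -/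
noncomputable def pathVelocity {n : ℕ} (F : ℝ → StdDiffeo n) (t : ℝ) (p : StdSpace n) :
    StdSpace n :=
  derivWithin (fun s => F s p) (Icc (0 : ℝ) 1) t

/-- A null path: the velocity is everywhere tangent to the contact structure. -/
def IsNullPath {n : ℕ} (F : ℝ → StdDiffeo n) : Prop :=
  ∀ t ∈ Icc (0 : ℝ) 1, ∀ p, pathVelocity F t p ∈ stdContactStructure n (F t p)

/-- A positive path: the velocity is everywhere positively transverse to the contact structure. -/
def IsPositivePath {n : ℕ} (F : ℝ → StdDiffeo n) : Prop :=
  ∀ t ∈ Icc (0 : ℝ) 1, ∀ p, 0 < stdContactForm n (F t p) (pathVelocity F t p)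

/-- A compactly supported path: all its diffeomorphisms are the identity outside one common
compact set. -/
def IsCompactlySupportedPath {n : ℕ} (F : ℝ → StdDiffeo n) : Prop :=
  ∃ K : Set (StdSpace n), IsCompact K ∧ ∀ t ∈ Icc (0 : ℝ) 1, ∀ p, p ∉ K → F t p = p

/-- All derivatives of order at most `r` of `g - id` have norm less than `ε` on `S`. The sets of
`g` with this property, for `r : ℕ`, `S` compact and `ε > 0`, form a basis of neighbourhoods of the
identity in the `C^∞`-compact-open topology. -/
def IsCloseToIdOn {n : ℕ} (r : ℕ) (S : Set (StdSpace n)) (ε : ℝ) (g : StdDiffeo n) : Prop :=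
  ∀ k ≤ r, ∀ p ∈ S, ‖iteratedFDeriv ℝ k (fun q => g q - q) p‖ < ε

/-!
A path of diffeomorphisms stays null when it is precomposed with a fixed diffeomorphism. Hence the
ends of null arcs with compact support in an open set `U` form a group (`NullReachable.trans`,
`NullReachable.symm`), which contains the small displacements along lines tangent to the contact
structure (`nullReachable_of_horizontal`).

The contact structure misses one direction, and bracket generation supplies it: conjugating by the
flow for time `ε` of `∂_{y₁} - x₁ ∂_z` turns the displacements along `∂_{x₁}` into displacements along
`∂_{x₁} - ε ∂_z` (`exists_nullReachable_of_oblique`). Together with `∂_{xᵢ}` and `∂_{yᵢ} - xᵢ ∂_z`,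
these directions span the tangent space, and a diffeomorphism `C¹`-close to the identity is a
composition of three displacements along them (`exists_nullReachable_of_small`). A
connectedness argument gives all ends of isotopies with compact support in `U`
(`nullReachable_of_isotopy`).

A diffeomorphism `f` without compact support is treated by exhaustion. Cutting off the isotopy to
`f⁻¹` (`IsotopicToIdRel.exists_eq_trans`) yields diffeomorphisms `d₀, d₁, …` such that
`d_k` is the end of a null arc compactly supported off a ball of radius about `k`, and
`d_{k-1} ∘ ⋯ ∘ d₀` agrees with `f` on the preimage under `f` of a slightly larger ball. The
concatenation of the infinitely many arcs, in the time `[0, 1)`, is locally stationary near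
the time `1`, so that it extends to a smooth null path that ends at `f`
(`exists_nullFamily_of_infinite_concatenation`).

Positive paths come for free: the flow `R_s` of the Reeb field `∂_z` preserves the contact form, so
that a null path `g_t` from the identity to `R_{-c} ∘ f`, `c > 0`, gives the positive path
`R_{ct} ∘ g_t` to `f`. To keep it close to the identity off the support of a null path to `f`, `c` is
chosen small and `R_{-c}` is reached by the horizontal lift of a small circle, which is an affine
null arc (`exists_isNullArc_reebFlow`).
-/

open Filter Topology
open scoped NNReal

/-! ### Perturbations of the identity and smooth families of diffeomorphisms -/

/-- A smooth bijection with invertible derivatives has a smooth inverse. -/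
theorem Equiv.contDiff_symm_of_injective_fderiv {E F : Type*} [NormedAddCommGroup E]
    [NormedSpace ℝ E] [FiniteDimensional ℝ E] [NormedAddCommGroup F] [NormedSpace ℝ F]
    [FiniteDimensional ℝ F] (hEF : Module.finrank ℝ E = Module.finrank ℝ F)
    (e : E ≃ F) (he : ContDiff ℝ ∞ e)
    (hinj : ∀ x, Function.Injective (fderiv ℝ e x)) : ContDiff ℝ ∞ e.symm := by
  rw [contDiff_iff_contDiffAt]
  intro y
  obtain ⟨x, rfl⟩ := e.surjective y
  let L : E ≃L[ℝ] F :=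
    (LinearEquiv.ofInjectiveOfFinrankEq (fderiv ℝ e x).toLinearMap (hinj x) hEF).toContinuousLinearEquiv
  have hL : HasFDerivAt e (L : E →L[ℝ] F) x := by
    have h1 : (L : E →L[ℝ] F) = fderiv ℝ e x := by ext v; rfl
    rw [h1]
    exact (he.differentiable (by simp) x).hasFDerivAt
  have hc : ContDiffAt ℝ ∞ e x := he.contDiffAt
  have hn : (∞ : WithTop ℕ∞) ≠ 0 := by simp
  have h1 := hc.to_localInverse hL hn
  refine h1.congr_of_eventuallyEq ?_
  have h2 := (hc.hasStrictFDerivAt' hL hn).eventually_right_inverse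
  filter_upwards [h2] with y hy
  rw [Equiv.symm_apply_eq]
  exact hy.symm

/-- A contraction perturbs the identity to a diffeomorphism. -/
theorem exists_diffeo_id_add {n : ℕ} {v : StdSpace n → StdSpace n} (hv : ContDiff ℝ ∞ v)
    {c : ℝ≥0} (hL : LipschitzWith c v) (hc : c < 1) :
    ∃ g : StdDiffeo n, ∀ p, g p = p + v p := by
  set f : StdSpace n → StdSpace n := fun p => p + v p with hf
  have happ : ApproximatesLinearOn f
      ((ContinuousLinearEquiv.refl ℝ (StdSpace n) : StdSpace n ≃L[ℝ] StdSpace n) :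
        StdSpace n →L[ℝ] StdSpace n) univ c := by
    rw [ApproximatesLinearOn.approximatesLinearOn_iff_lipschitzOnWith]
    have : (f - ⇑((ContinuousLinearEquiv.refl ℝ (StdSpace n) : StdSpace n ≃L[ℝ] StdSpace n) :
        StdSpace n →L[ℝ] StdSpace n)) = v := by
      ext1 p; simp [hf]
    rw [this]
    exact hL.lipschitzOnWith
  have hc' : c < ‖((ContinuousLinearEquiv.refl ℝ (StdSpace n)).symm :
      StdSpace n →L[ℝ] StdSpace n)‖₊⁻¹ := by
    have h1 : ‖((ContinuousLinearEquiv.refl ℝ (StdSpace n)).symm :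
      StdSpace n →L[ℝ] StdSpace n)‖₊ = 1 := by
      have := ContinuousLinearMap.norm_id (𝕜 := ℝ) (E := StdSpace n)
      exact NNReal.eq this
    rw [h1]; simpa using hc
  have hbij : Function.Bijective f :=
    ⟨injOn_univ.mp (happ.injOn (Or.inr hc')), happ.surjective (Or.inr hc')⟩
  have hfs : ContDiff ℝ ∞ f := contDiff_id.add hv
  let e := Equiv.ofBijective f hbij
  have hsymm : ContDiff ℝ ∞ e.symm := by
    refine Equiv.contDiff_symm_of_injective_fderiv rfl e hfs fun x => ?_
    rw [injective_iff_map_eq_zero]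
    intro w hw
    have hd : fderiv ℝ e x w = w + fderiv ℝ v x w := by
      have : HasFDerivAt f (ContinuousLinearMap.id ℝ _ + fderiv ℝ v x) x :=
        (hasFDerivAt_id x).add (hv.differentiable (by simp) x).hasFDerivAt
      change fderiv ℝ f x w = _
      rw [this.fderiv]; rfl
    rw [hd] at hw
    have h1 : ‖w‖ ≤ c * ‖w‖ := by
      calc ‖w‖ = ‖fderiv ℝ v x w‖ := by
            conv_lhs => rw [eq_neg_of_add_eq_zero_left hw, norm_neg]
        _ ≤ ‖fderiv ℝ v x‖ * ‖w‖ := ContinuousLinearMap.le_opNorm _ _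
        _ ≤ c * ‖w‖ := by
            gcongr
            exact norm_fderiv_le_of_lipschitz ℝ hL
    have h2 : (c : ℝ) < 1 := by exact_mod_cast hc
    by_contra h0
    have := norm_pos_iff.mpr h0
    nlinarith
  exact ⟨⟨e, hfs.contMDiff, hsymm.contMDiff⟩, fun p => rfl⟩

/-- The inverse of a diffeomorphism `id + v` with `Lip v ≤ 1/2` is `2`-Lipschitz. -/
theorem lipschitzWith_symm_of_id_add {n : ℕ} {v : StdSpace n → StdSpace n}
    (hL : LipschitzWith (1 / 2) v) {g : StdDiffeo n} (hg : ∀ p, g p = p + v p) :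
    LipschitzWith 2 g.symm := by
  refine LipschitzWith.of_dist_le_mul fun p q => ?_
  set a := g.symm p
  set b := g.symm q
  have hp : p = a + v a := by rw [← hg]; exact (g.apply_symm_apply p).symm
  have hq : q = b + v b := by rw [← hg]; exact (g.apply_symm_apply q).symm
  have h1 := hL.dist_le_mul a b
  rw [dist_eq_norm] at h1 ⊢
  rw [dist_eq_norm] at h1 ⊢
  have h2 : a - b = (p - q) - (v a - v b) := by rw [hp, hq]; abel
  have h3 : ‖a - b‖ ≤ ‖p - q‖ + ‖v a - v b‖ := by
    conv_lhs => rw [h2]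
    exact norm_sub_le _ _
  norm_num at h1 ⊢
  linarith

/-- A family of diffeomorphisms `F t`, `t ∈ ℝ`, is smooth if `F t p` is jointly smooth. Taking all
real parameters avoids one-sided derivatives. -/
def IsSmoothFamily {n : ℕ} (F : ℝ → StdDiffeo n) : Prop :=
  ContDiff ℝ ∞ (fun q : ℝ × StdSpace n => F q.1 q.2)

namespace IsSmoothFamily

variable {n : ℕ} {F G : ℝ → StdDiffeo n}

theorem const (g : StdDiffeo n) : IsSmoothFamily fun _ => g :=
  g.contDiff.comp contDiff_snd

theorem trans (hF : IsSmoothFamily F) (hG : IsSmoothFamily G) :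
    IsSmoothFamily fun t => (F t).trans (G t) :=
  ContDiff.comp (g := fun q : ℝ × StdSpace n => G q.1 q.2)
    (f := fun q : ℝ × StdSpace n => (q.1, F q.1 q.2)) hG (contDiff_fst.prodMk hF)

theorem reparam (hF : IsSmoothFamily F) {u : ℝ → ℝ} (hu : ContDiff ℝ ∞ u) :
    IsSmoothFamily fun t => F (u t) :=
  ContDiff.comp (g := fun q : ℝ × StdSpace n => F q.1 q.2)
    (f := fun q : ℝ × StdSpace n => (u q.1, q.2)) hF ((hu.comp contDiff_fst).prodMk contDiff_snd)

/-- The inverse function theorem is applied to `(t, p) ↦ (t, F t p)`. -/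
theorem symm (hF : IsSmoothFamily F) : IsSmoothFamily fun t => (F t).symm := by
  let e : ℝ × StdSpace n ≃ ℝ × StdSpace n :=
    { toFun := fun q => (q.1, F q.1 q.2)
      invFun := fun q => (q.1, (F q.1).symm q.2)
      left_inv := fun q => by simp
      right_inv := fun q => by simp }
  have he : ContDiff ℝ ∞ e := contDiff_fst.prodMk hF
  have h := Equiv.contDiff_symm_of_injective_fderiv rfl e he fun x => by
    rw [injective_iff_map_eq_zero]
    rintro ⟨τ, w⟩ hw
    have hFd : HasFDerivAt (fun q : ℝ × StdSpace n => F q.1 q.2)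
        (fderiv ℝ (fun q : ℝ × StdSpace n => F q.1 q.2) x) x :=
      (ContDiff.differentiable hF (by simp) x).hasFDerivAt
    have hd : HasFDerivAt e ((ContinuousLinearMap.fst ℝ ℝ (StdSpace n)).prod
        (fderiv ℝ (fun q : ℝ × StdSpace n => F q.1 q.2) x)) x := hasFDerivAt_fst.prodMk hFd
    rw [hd.fderiv] at hw
    have h1 : τ = 0 := congrArg Prod.fst hw
    have h2 : fderiv ℝ (fun q : ℝ × StdSpace n => F q.1 q.2) x (τ, w) = 0 := congrArg Prod.snd hw
    subst h1
    have h3 : HasFDerivAt (fun p => F x.1 p) ((fderiv ℝ (fun q : ℝ × StdSpace n => F q.1 q.2) x).comp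
        (ContinuousLinearMap.inr ℝ ℝ (StdSpace n))) x.2 := by
      have h4 : HasFDerivAt (fun p : StdSpace n => (x.1, p))
        (ContinuousLinearMap.inr ℝ ℝ (StdSpace n)) x.2 := hasFDerivAt_prodMk_right x.1 x.2
      exact HasFDerivAt.comp (g := fun q : ℝ × StdSpace n => F q.1 q.2) x.2 hFd h4
    have h5 : HasFDerivAt (F x.1).symm (fderiv ℝ (F x.1).symm (F x.1 x.2)) (F x.1 x.2) :=
      ((F x.1).symm.contDiff.differentiable (by simp) _).hasFDerivAt
    have h6 := h5.comp x.2 h3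
    have h7 : (⇑(F x.1).symm ∘ fun p => F x.1 p) = id := by ext1 p; simp
    rw [h7] at h6
    have h8 := h6.unique (hasFDerivAt_id x.2)
    have h9 := DFunLike.congr_fun h8 w
    have h10 : w = 0 := by
      simp only [ContinuousLinearMap.comp_apply, ContinuousLinearMap.inr_apply, h2, map_zero] at h9
      exact h9.symm
    rw [h10]; rfl
  exact contDiff_snd.comp h

theorem contDiff_curve (hF : IsSmoothFamily F) (p : StdSpace n) :
    ContDiff ℝ ∞ fun t => F t p :=
  ContDiff.comp (g := fun q : ℝ × StdSpace n => F q.1 q.2)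
    (f := fun t : ℝ => (t, p)) hF (contDiff_id.prodMk contDiff_const)

end IsSmoothFamily

/-- A smooth family of maps supported in a common compact set is `C¹`-small near a parameter where it
vanishes. -/
theorem eventually_small_of_eq_zero {n : ℕ} {V : ℝ × StdSpace n → StdSpace n}
    (hV : ContDiff ℝ ∞ V) {K : Set (StdSpace n)} (hK : IsCompact K)
    (hsupp : ∀ t, ∀ p ∉ K, V (t, p) = 0) {t₀ : ℝ} (h0 : ∀ p, V (t₀, p) = 0) {δ : ℝ≥0}
    (hδ : 0 < δ) :
    ∀ᶠ t in 𝓝 t₀, (∀ p, ‖V (t, p)‖ ≤ δ) ∧ LipschitzWith δ fun p => V (t, p) := by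
  have hd : ∀ t p, HasFDerivAt (fun p => V (t, p)) ((fderiv ℝ V (t, p)).comp
      (ContinuousLinearMap.inr ℝ ℝ (StdSpace n))) p := fun t p =>
    HasFDerivAt.comp (g := V) p (hV.differentiable (by simp) _).hasFDerivAt
      (hasFDerivAt_prodMk_right t p)
  have hcont : Continuous fun q : ℝ × StdSpace n => (fderiv ℝ V q).comp
      (ContinuousLinearMap.inr ℝ ℝ (StdSpace n)) :=
    (hV.continuous_fderiv (by simp)).clm_comp continuous_const
  have hδ' : (0 : ℝ) < δ := hδ
  have h1 : ∀ᶠ t in 𝓝 t₀, ∀ p ∈ K, ‖V (t, p)‖ < δ ∧ ‖(fderiv ℝ V (t, p)).comp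
      (ContinuousLinearMap.inr ℝ ℝ (StdSpace n))‖ < δ := by
    refine hK.eventually_forall_of_forall_eventually fun p _ => ?_
    refine Filter.Eventually.and ?_ ?_
    · have : Tendsto (fun q => ‖V q‖) (𝓝 (t₀, p)) (𝓝 ‖V (t₀, p)‖) :=
        hV.continuous.norm.continuousAt
      rw [h0, norm_zero] at this
      exact this.eventually_lt_const hδ'
    · have : Tendsto (fun q : ℝ × StdSpace n => ‖(fderiv ℝ V q).comp
          (ContinuousLinearMap.inr ℝ ℝ (StdSpace n))‖) (𝓝 (t₀, p)) (𝓝 ‖(fderiv ℝ V (t₀, p)).comp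
          (ContinuousLinearMap.inr ℝ ℝ (StdSpace n))‖) := hcont.norm.continuousAt
      have hz : (fderiv ℝ V (t₀, p)).comp (ContinuousLinearMap.inr ℝ ℝ (StdSpace n)) = 0 := by
        rw [← (hd t₀ p).fderiv]
        have : (fun p => V (t₀, p)) = fun _ => 0 := funext h0
        rw [this]; simp
      rw [hz, norm_zero] at this
      exact this.eventually_lt_const hδ'
  filter_upwards [h1] with t ht
  refine ⟨fun p => ?_, ?_⟩
  · by_cases hp : p ∈ K
    · exact (ht p hp).1.le
    · rw [hsupp t p hp, norm_zero]; exact hδ'.le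
  · refine lipschitzWith_of_nnnorm_fderiv_le (𝕜 := ℝ)
      (fun p => (hd t p).differentiableAt) fun p => ?_
    rw [(hd t p).fderiv]
    by_cases hp : p ∈ K
    · exact (ht p hp).2.le
    · rw [← (hd t p).fderiv]
      have : (fun p => V (t, p)) =ᶠ[𝓝 p] fun _ => 0 := by
        filter_upwards [hK.isClosed.isOpen_compl.mem_nhds hp] with q hq using hsupp t q hq
      rw [this.fderiv_eq]; simp

/-! ### Null families and null arcs -/

/-- A smooth family whose curves `t ↦ F t p` are everywhere tangent to the contact structure. -/
structure IsNullFamily {n : ℕ} (F : ℝ → StdDiffeo n) : Prop where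
  smooth : IsSmoothFamily F
  null : ∀ t p, stdContactForm n (F t p) (deriv (fun s => F s p) t) = 0

namespace IsNullFamily

variable {n : ℕ} {F G : ℝ → StdDiffeo n}

theorem reparam (hF : IsNullFamily F) {u : ℝ → ℝ} (hu : ContDiff ℝ ∞ u) :
    IsNullFamily fun t => F (u t) := by
  refine ⟨hF.smooth.reparam hu, fun t p => ?_⟩
  have h1 : HasDerivAt (fun s => F s p) (deriv (fun s => F s p) (u t)) (u t) :=
    ((hF.smooth.contDiff_curve p).differentiable (by simp) _).hasDerivAt
  have h2 : HasDerivAt u (deriv u t) t := (hu.differentiable (by simp) _).hasDerivAt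
  have h3 : deriv (fun s => F (u s) p) t = deriv u t • deriv (fun s => F s p) (u t) :=
    (h1.scomp t h2).deriv
  rw [h3, map_smul, hF.null, smul_zero]

theorem const_trans (hF : IsNullFamily F) (g : StdDiffeo n) :
    IsNullFamily fun t => g.trans (F t) :=
  ⟨(IsSmoothFamily.const g).trans hF.smooth, fun t p => hF.null t (g p)⟩

theorem refl : IsNullFamily fun _ : ℝ => Diffeomorph.refl 𝓘(ℝ, StdSpace n) (StdSpace n) ∞ :=
  ⟨IsSmoothFamily.const _, fun t p => by simp⟩

/-- The pointwise composition of two null families is null if, near every parameter, the second one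
is the identity or the first one is stationary. -/
theorem trans (hF : IsNullFamily F) (hG : IsNullFamily G)
    (h : ∀ t, (∀ᶠ s in 𝓝 t, ∀ p, G s p = p) ∨ ∃ g : StdDiffeo n, ∀ᶠ s in 𝓝 t, ∀ p, F s p = g p) :
    IsNullFamily fun t => (F t).trans (G t) := by
  refine ⟨hF.smooth.trans hG.smooth, fun t p => ?_⟩
  rcases h t with h | ⟨g, h⟩
  · have h1 : (fun s => (F s).trans (G s) p) =ᶠ[𝓝 t] fun s => F s p := by
      filter_upwards [h] with s hs using hs _
    rw [h1.deriv_eq, show (F t).trans (G t) p = F t p from h1.self_of_nhds]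
    exact hF.null t p
  · have h1 : (fun s => (F s).trans (G s) p) =ᶠ[𝓝 t] fun s => G s (g p) := by
      filter_upwards [h] with s hs
      simp [hs p]
    rw [h1.deriv_eq, show (F t).trans (G t) p = G t (g p) from h1.self_of_nhds]
    exact hG.null t (g p)

end IsNullFamily

/-- A null family that runs from the identity to `f`, and is stationary near the ends of the
parameter interval `[0, 1]` and beyond, so that concatenations are smooth. -/
structure IsNullArc {n : ℕ} (F : ℝ → StdDiffeo n) (f : StdDiffeo n) : Prop
    extends IsNullFamily F where
  start : ∀ t ≤ 1 / 3, ∀ p, F t p = p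
  finish : ∀ t ≥ 2 / 3, ∀ p, F t p = f p

/-- The concatenation of two null arcs. The first one moves only for `t ∈ [1/3, 5/12]`, the second one
only for `t ∈ [7/12, 2/3]`. -/
theorem IsNullArc.trans {n : ℕ} {F G : ℝ → StdDiffeo n} {f g : StdDiffeo n}
    (hF : IsNullArc F f) (hG : IsNullArc G g) :
    IsNullArc (fun t => (F (4 * t - 1)).trans (G (4 * t - 2))) (f.trans g) := by
  refine ⟨(hF.reparam (by fun_prop)).trans (hG.reparam (by fun_prop)) fun t => ?_,
    fun t ht p => ?_, fun t ht p => ?_⟩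
  · rcases lt_or_ge t (7 / 12) with h | h
    · left
      filter_upwards [gt_mem_nhds h] with s hs using hG.start _ (by linarith)
    · right
      refine ⟨f, ?_⟩
      filter_upwards [lt_mem_nhds (show 5 / 12 < t by linarith)] with s hs using
        hF.finish _ (by linarith)
  · simp [hF.start (4 * t - 1) (by linarith), hG.start (4 * t - 2) (by linarith)]
  · simp [hF.finish (4 * t - 1) (by linarith), hG.finish (4 * t - 2) (by linarith)]

/-- `f` can be joined to the identity by a null arc with compact support in `U`. -/
def NullReachable {n : ℕ} (U : Set (StdSpace n)) (f : StdDiffeo n) : Prop :=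
  ∃ (F : ℝ → StdDiffeo n) (K : Set (StdSpace n)), IsNullArc F f ∧ IsCompact K ∧ K ⊆ U ∧
    ∀ t, ∀ p ∉ K, F t p = p

namespace NullReachable

variable {n : ℕ} {U : Set (StdSpace n)} {f g : StdDiffeo n}

theorem trans (hf : NullReachable U f) (hg : NullReachable U g) : NullReachable U (f.trans g) := by
  obtain ⟨F, K, hF, hK, hKU, hFK⟩ := hf
  obtain ⟨G, L, hG, hL, hLU, hGL⟩ := hg
  refine ⟨_, K ∪ L, hF.trans hG, hK.union hL, union_subset hKU hLU, fun t p hp => ?_⟩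
  rw [mem_union, not_or] at hp
  simp [hFK _ p hp.1, hGL _ p hp.2]

theorem symm (hf : NullReachable U f) : NullReachable U f.symm := by
  obtain ⟨F, K, hF, hK, hKU, hFK⟩ := hf
  have hfK : ∀ p ∉ K, f.symm p = p := fun p hp => by
    conv_lhs => rw [← hFK 1 p hp, hF.finish 1 (by norm_num), f.symm_apply_apply]
  -- the reversed arc, precomposed with `f⁻¹`: precomposition does not change the velocities
  refine ⟨fun t => f.symm.trans (F (1 - t)), K,
    ⟨(hF.reparam (by fun_prop)).const_trans _, fun t ht p => ?_, fun t ht p => ?_⟩, hK, hKU,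
    fun t p hp => ?_⟩
  · simp [hF.finish (1 - t) (by linarith)]
  · simp [hF.start (1 - t) (by linarith)]
  · simp [hfK p hp, hFK _ p hp]

end NullReachable

/-! ### Small displacements along horizontal and oblique directions -/

/-- A smooth `[0, 1]`-valued step function, constant outside `[1/3, 2/3]`. -/
noncomputable def smoothStep (t : ℝ) : ℝ := Real.smoothTransition (3 * t - 1)

theorem contDiff_smoothStep : ContDiff ℝ ∞ smoothStep :=
  Real.smoothTransition.contDiff.comp (by fun_prop)

theorem smoothStep_nonneg (t : ℝ) : 0 ≤ smoothStep t := Real.smoothTransition.nonneg _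

theorem smoothStep_le_one (t : ℝ) : smoothStep t ≤ 1 := Real.smoothTransition.le_one _

theorem smoothStep_of_le {t : ℝ} (ht : t ≤ 1 / 3) : smoothStep t = 0 :=
  Real.smoothTransition.zero_of_nonpos (by linarith)

theorem smoothStep_of_ge {t : ℝ} (ht : 2 / 3 ≤ t) : smoothStep t = 1 :=
  Real.smoothTransition.one_of_one_le (by linarith)

theorem exists_smooth_cutoff {n : ℕ} {K U : Set (StdSpace n)} (hK : IsCompact K) (hU : IsOpen U)
    (hKU : K ⊆ U) : ∃ (χ : StdSpace n → ℝ) (L : Set (StdSpace n)), ContDiff ℝ ∞ χ ∧ IsCompact L ∧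
      L ⊆ U ∧ (∀ p ∈ K, χ p = 1) ∧ ∀ p ∉ L, χ p = 0 := by
  obtain ⟨L, hL, hKL, hLU⟩ := exists_compact_between hK hU hKU
  obtain ⟨χ, h1, h0, -⟩ := exists_contMDiffMap_one_nhds_of_subset_interior (n := (⊤ : ℕ∞))
    𝓘(ℝ, StdSpace n) hK.isClosed hKL
  exact ⟨χ, L, χ.contMDiff.contDiff, hL, hLU, fun p hp => h1.self_of_nhdsSet p hp, h0⟩

/-- The linear interpolation `p + θ v(p)`, `0 ≤ θ ≤ 1`, from the identity to `id + v`
is null if `v` is tangent to the contact structure along the segments `[p, p + v(p)]`. -/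
theorem nullReachable_of_horizontal {n : ℕ} {K U : Set (StdSpace n)} (hK : IsCompact K)
    (hKU : K ⊆ U) {v : StdSpace n → StdSpace n} (hv : ContDiff ℝ ∞ v) (hvK : ∀ p ∉ K, v p = 0)
    (hL : LipschitzWith (1 / 2) v) (hnull : ∀ p t, stdContactForm n (p + (t : ℝ) • v p) (v p) = 0)
    {g : StdDiffeo n} (hg : ∀ p, g p = p + v p) : NullReachable U g := by
  have hex : ∀ t : ℝ, ∃ f : StdDiffeo n, ∀ p, f p = p + smoothStep t • v p := fun t => by
    refine exists_diffeo_id_add (c := 1 / 2) (hv.const_smul _) ?_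
      (by rw [← NNReal.coe_lt_coe]; norm_num)
    rw [lipschitzWith_iff_norm_sub_le] at hL ⊢
    intro p q
    rw [← smul_sub, norm_smul, Real.norm_of_nonneg (smoothStep_nonneg t)]
    exact (mul_le_of_le_one_left (norm_nonneg _) (smoothStep_le_one t)).trans (hL p q)
  choose F hF using hex
  refine ⟨F, K, ⟨⟨?_, fun t p => ?_⟩, fun t ht p => ?_, fun t ht p => ?_⟩, hK, hKU,
    fun t p hp => ?_⟩
  · simp only [IsSmoothFamily, hF]
    exact contDiff_snd.add ((contDiff_smoothStep.comp contDiff_fst).smul (hv.comp contDiff_snd))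
  · have h1 : HasDerivAt (fun s => F s p) (deriv smoothStep t • v p) t := by
      simp only [hF]
      exact ((contDiff_smoothStep.differentiable (by simp) t).hasDerivAt.smul_const
        (v p)).const_add p
    rw [h1.deriv, map_smul, hF, hnull, smul_zero]
  · simp [hF, smoothStep_of_le ht]
  · simp [hF, smoothStep_of_ge ht, hg]
  · simp [hF, hvK p hp]

/-- A bijection that fixes the complement of `K` pointwise preserves `K`. -/
theorem Diffeomorph.apply_mem_of_fix {n : ℕ} {K : Set (StdSpace n)} {g : StdDiffeo n}
    (hg : ∀ p ∉ K, g p = p) {p : StdSpace n} (hp : p ∈ K) : g p ∈ K := by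
  by_contra h
  have h1 : g p = p := g.injective (hg _ h)
  exact h (by rwa [h1])

theorem Diffeomorph.symm_apply_of_fix {n : ℕ} {g : StdDiffeo n} {p : StdSpace n}
    (hg : g p = p) : g.symm p = p := by
  conv_lhs => rw [← hg, g.symm_apply_apply]

/-- The flow for time `ε` of the horizontal field `∂_y - x ∂_z` (one pair of coordinates) turns
`∂_x` into `∂_x - ε ∂_z`. Conjugating by a cut-off of this flow therefore makes small displacements
along the constant direction `∂_x - ε ∂_z`, which is not horizontal, reachable by null arcs. -/
theorem exists_nullReachable_of_oblique {n : ℕ} (i : Fin n) {K U : Set (StdSpace n)}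
    (hK : IsCompact K) (hU : IsOpen U) (hKU : K ⊆ U) :
    ∃ ε : ℝ, 0 < ε ∧ ε ≤ 1 ∧ ∀ κ : StdSpace n → ℝ, ContDiff ℝ ∞ κ → (∀ p ∉ K, κ p = 0) →
      LipschitzWith (1 / 4) κ → ∀ Θ : StdDiffeo n,
      (∀ p, Θ p = p + κ p • ((Pi.single i 1, 0, -ε) : StdSpace n)) → NullReachable U Θ := by
  obtain ⟨η, hη, hηU⟩ := hK.exists_cthickening_subset_open hU hKU
  set K₁ := Metric.cthickening η K with hK₁
  have hK₁c : IsCompact K₁ := hK.cthickening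
  obtain ⟨χ, L, hχ, hL, hLU, hχ1, hχ0⟩ := exists_smooth_cutoff hK₁c hU hηU
  set Y : StdSpace n → StdSpace n := fun p => (0, Pi.single i 1, -p.1 i) with hY
  have hYs : ContDiff ℝ ∞ Y := by
    refine contDiff_const.prodMk (contDiff_const.prodMk ?_)
    exact ((contDiff_apply ℝ ℝ i).comp contDiff_fst).neg
  have hχY : ContDiff ℝ ∞ fun p => χ p • Y p := hχ.smul hYs
  obtain ⟨C, hC⟩ := hχY.lipschitzWith_of_hasCompactSupport
    (HasCompactSupport.intro hL fun p hp => by rw [hχ0 p hp, zero_smul]) (by simp)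
  obtain ⟨M, hM⟩ := hK.isBounded.exists_norm_le
  have hM' : ∀ p ∈ K, |p.1 i| ≤ |M| := fun p hp =>
    ((norm_le_pi_norm p.1 i).trans (norm_fst_le p)).trans ((hM p hp).trans (le_abs_self M))
  -- the flow for time `ε` moves `K` by at most `η`, and its cut-off is still a diffeomorphism
  obtain ⟨ε, hε, hε1, hεη, hεC⟩ : ∃ ε : ℝ, 0 < ε ∧ ε ≤ 1 ∧ ε * (1 + |M|) ≤ η ∧ ε * C ≤ 1 / 2 := by
    have h1 : 0 < 1 + |M| := by positivity
    have h2 : (0 : ℝ) < C + 1 := by positivity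
    refine ⟨min 1 (min (η / (1 + |M|)) (1 / (2 * (C + 1)))), by positivity, min_le_left _ _, ?_, ?_⟩
    · rw [← le_div_iff₀ h1]
      exact (min_le_right _ _).trans (min_le_left _ _)
    · calc _ ≤ 1 / (2 * (C + 1)) * (C : ℝ) := by
            gcongr
            exact (min_le_right _ _).trans (min_le_right _ _)
        _ ≤ 1 / (2 * (C + 1)) * (C + 1 : ℝ) := by gcongr; linarith
        _ = 1 / 2 := by field_simp
  refine ⟨ε, hε, hε1, fun κ hκ hκK hκL Θ hΘ => ?_⟩
  have hφv : ContDiff ℝ ∞ fun p => ε • χ p • Y p := hχY.const_smul ε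
  have hφL : LipschitzWith (1 / 2) fun p => ε • χ p • Y p := by
    rw [lipschitzWith_iff_norm_sub_le] at hC ⊢
    intro p q
    rw [← smul_sub, norm_smul, Real.norm_of_nonneg hε.le]
    calc _ ≤ ε * (C * ‖p - q‖) := by gcongr; exact hC p q
      _ = (ε * C) * ‖p - q‖ := by ring
      _ ≤ _ := by push_cast; gcongr
  -- `φ` is the cut-off of the affine flow `Φ` below; the two agree on `K₁`
  obtain ⟨φ, hφ⟩ := exists_diffeo_id_add hφv hφL (by rw [← NNReal.coe_lt_coe]; norm_num)
  have hφN : NullReachable U φ := by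
    refine nullReachable_of_horizontal hL hLU hφv (fun p hp => by simp [hχ0 p hp]) hφL
      (fun p t => ?_) hφ
    simp [stdContactForm_apply, hY, Pi.single_apply]
    ring
  set Φ : StdSpace n → StdSpace n := fun p => p + ε • Y p with hΦ
  have hΦK : ∀ p, Φ p ∈ K → p ∈ K₁ := fun p hp => by
    refine Metric.mem_cthickening_of_dist_le p (Φ p) η K hp ?_
    have h1 : |p.1 i| ≤ |M| := by simpa [hΦ, hY] using hM' _ hp
    rw [dist_eq_norm, hΦ]
    simp only [sub_add_cancel_left, norm_neg, norm_smul, Real.norm_of_nonneg hε.le]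
    refine le_trans ?_ hεη
    gcongr
    simp only [hY, Prod.norm_def, norm_zero, norm_neg, Real.norm_eq_abs]
    have h2 : ‖(Pi.single i 1 : Fin n → ℝ)‖ ≤ 1 := by rw [Pi.norm_single, norm_one]
    have := abs_nonneg M
    refine max_le (by linarith) (max_le (by linarith) (by linarith))
  have hφΦ : ∀ p ∈ K₁, φ p = Φ p := fun p hp => by rw [hφ, hχ1 p hp, one_smul]
  have hΦs : ContDiff ℝ ∞ Φ := contDiff_id.add (hYs.const_smul ε)
  set b : StdSpace n → StdSpace n := fun p => κ (Φ p) • ((Pi.single i 1, 0, 0) : StdSpace n) with hb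
  have hbs : ContDiff ℝ ∞ b := (hκ.comp hΦs).smul contDiff_const
  have hsingle : ‖((Pi.single i 1, 0, 0) : StdSpace n)‖ ≤ 1 := by
    simp only [Prod.norm_def, norm_zero]
    exact max_le (by rw [Pi.norm_single, norm_one]) (by simp)
  have hbL : LipschitzWith (1 / 2) b := by
    rw [lipschitzWith_iff_norm_sub_le] at hκL ⊢
    intro p q
    have h1 : ‖Φ p - Φ q‖ ≤ 2 * ‖p - q‖ := by
      have h2 : Φ p - Φ q = (p - q) + ε • ((0, 0, -(p - q).1 i) : StdSpace n) := by
        ext j <;> simp [hΦ, hY]; ring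
      have h3 : ‖((0, 0, -(p - q).1 i) : StdSpace n)‖ ≤ ‖p - q‖ := by
        simp only [Prod.norm_mk, norm_zero, norm_neg]
        refine max_le (norm_nonneg _) (max_le (norm_nonneg _) ?_)
        exact (norm_le_pi_norm (p - q).1 i).trans (norm_fst_le _)
      calc ‖Φ p - Φ q‖ ≤ ‖p - q‖ + ε * ‖((0, 0, -(p - q).1 i) : StdSpace n)‖ := by
            rw [h2]
            refine (norm_add_le _ _).trans ?_
            rw [norm_smul, Real.norm_of_nonneg hε.le]
        _ ≤ ‖p - q‖ + 1 * ‖p - q‖ := by gcongr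
        _ = 2 * ‖p - q‖ := by ring
    calc ‖b p - b q‖ = ‖κ (Φ p) - κ (Φ q)‖ * ‖((Pi.single i 1, 0, 0) : StdSpace n)‖ := by
          rw [hb, ← norm_smul, sub_smul]
      _ ≤ ‖κ (Φ p) - κ (Φ q)‖ * 1 := by gcongr
      _ ≤ (1 / 4 : ℝ≥0) * (2 * ‖p - q‖) := by
          rw [mul_one]
          exact (hκL _ _).trans (by gcongr)
      _ = _ := by push_cast; ring
  obtain ⟨Ξ, hΞ⟩ := exists_diffeo_id_add hbs hbL (by rw [← NNReal.coe_lt_coe]; norm_num)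
  have hbK : ∀ p ∉ K₁, b p = 0 := fun p hp => by
    have : κ (Φ p) = 0 := hκK _ fun h => hp (hΦK p h)
    simp [hb, this]
  have hΞN : NullReachable U Ξ :=
    nullReachable_of_horizontal hK₁c hηU hbs hbK hbL
      (fun p t => by simp [stdContactForm_apply, hb]) hΞ
  have hΘK : ∀ p ∉ K, Θ p = p := fun p hp => by rw [hΘ, hκK p hp, zero_smul, add_zero]
  -- `Φ ∘ Ξ = Θ ∘ Φ`, since the linear part of `Φ` maps `∂_x` to `∂_x - ε ∂_z`
  have hΘeq : Θ = φ.symm.trans (Ξ.trans φ) := by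
    ext1 q
    obtain ⟨r, rfl⟩ : ∃ r, φ r = q := ⟨φ.symm q, φ.apply_symm_apply q⟩
    simp only [Diffeomorph.coe_trans, Function.comp_apply, Diffeomorph.symm_apply_apply]
    by_cases hr : Φ r ∈ K
    · have hrK := hΦK r hr
      have h1 : Φ (Ξ r) = Θ (Φ r) := by
        rw [hΘ, hΞ]
        ext j
        · simp [hΦ, hb, hY]
        · simp [hΦ, hb, hY]
        · simp [hΦ, hb, hY]
          ring
      have h2 : Ξ r ∈ K₁ := hΦK _ (by rw [h1]; exact Diffeomorph.apply_mem_of_fix hΘK hr)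
      rw [hφΦ r hrK, hφΦ _ h2, h1]
    · have h1 : Ξ r = r := by rw [hΞ, hb]; simp [hκK _ hr]
      rw [h1]
      apply hΘK
      -- otherwise `φ r` would be the image under `Φ = φ` of a point of `K₁`
      intro h
      set s : StdSpace n := φ r - ε • Y (φ r) with hs
      have h2 : Φ s = φ r := by
        simp only [hΦ, hs]
        ext j <;> simp [hY]
      have h3 : φ s = φ r := by rw [hφΦ s (hΦK s (by rwa [h2])), h2]
      rw [φ.injective h3] at h2
      exact hr (by rwa [h2])
  rw [hΘeq]
  exact hφN.symm.trans (hΞN.trans hφN)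

/-! ### Diffeomorphisms close to the identity -/

/-- The horizontal lift `∑ hᵢ (∂_{yᵢ} - xᵢ ∂_z)` of a displacement `h` of the `y`-coordinates. -/
def horizontalLift {n : ℕ} (h : StdSpace n → Fin n → ℝ) (p : StdSpace n) : StdSpace n :=
  (0, h p, -∑ i, p.1 i * h p i)

theorem ContDiff.horizontalLift {n : ℕ} {h : StdSpace n → Fin n → ℝ} (hh : ContDiff ℝ ∞ h) :
    ContDiff ℝ ∞ (horizontalLift h) := by
  refine contDiff_const.prodMk (hh.prodMk (ContDiff.neg (ContDiff.sum fun i _ => ?_)))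
  exact ((contDiff_apply ℝ ℝ i).comp contDiff_fst).mul ((contDiff_apply ℝ ℝ i).comp hh)

/-- The lift of a `C¹`-small displacement supported in a bounded set is `C¹`-small. -/
theorem norm_horizontalLift_sub_le {n : ℕ} {h : StdSpace n → Fin n → ℝ} {K : Set (StdSpace n)}
    {M δ : ℝ} (hM : 0 ≤ M) (hδ : 0 ≤ δ) (hK : ∀ p ∈ K, ‖p‖ ≤ M) (hhK : ∀ p ∉ K, h p = 0)
    (hb : ∀ p, ‖h p‖ ≤ δ) (hL : ∀ p q, ‖h p - h q‖ ≤ δ * ‖p - q‖) (p q : StdSpace n) :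
    ‖horizontalLift h p - horizontalLift h q‖ ≤ δ * (n * (M + 1) + 1) * ‖p - q‖ := by
  have hcoord : ∀ (a : StdSpace n) i, |a.1 i| ≤ ‖a‖ := fun a i =>
    (norm_le_pi_norm a.1 i).trans (norm_fst_le a)
  -- the product rule, with `x` evaluated at the point of `K`
  have key : ∀ p ∈ K, ∀ q i, |p.1 i * h p i - q.1 i * h q i| ≤ (M + 1) * δ * ‖p - q‖ := by
    intro p hp q i
    have h1 : |p.1 i| ≤ M := (hcoord p i).trans (hK p hp)
    have h2 : |h p i - h q i| ≤ δ * ‖p - q‖ := (norm_le_pi_norm (h p - h q) i).trans (hL p q)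
    have h3 : |p.1 i - q.1 i| ≤ ‖p - q‖ := hcoord (p - q) i
    have h4 : |h q i| ≤ δ := (norm_le_pi_norm (h q) i).trans (hb q)
    calc |p.1 i * h p i - q.1 i * h q i|
        = |p.1 i * (h p i - h q i) + (p.1 i - q.1 i) * h q i| := by congr 1; ring
      _ ≤ |p.1 i| * |h p i - h q i| + |p.1 i - q.1 i| * |h q i| := by
          rw [← abs_mul, ← abs_mul]; exact abs_add_le _ _
      _ ≤ M * (δ * ‖p - q‖) + ‖p - q‖ * δ := by gcongr
      _ = _ := by ring
  have hterm : ∀ i, |p.1 i * h p i - q.1 i * h q i| ≤ (M + 1) * δ * ‖p - q‖ := by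
    intro i
    by_cases hp : p ∈ K
    · exact key p hp q i
    by_cases hq : q ∈ K
    · rw [abs_sub_comm, norm_sub_rev]; exact key q hq p i
    · rw [hhK p hp, hhK q hq]
      simp only [Pi.zero_apply, mul_zero, sub_zero, abs_zero]
      positivity
  have hsum : |∑ i, p.1 i * h p i - ∑ i, q.1 i * h q i| ≤ n * ((M + 1) * δ * ‖p - q‖) := by
    rw [← Finset.sum_sub_distrib]
    refine (Finset.abs_sum_le_sum_abs _ _).trans ?_
    refine (Finset.sum_le_sum fun i _ => hterm i).trans ?_
    simp
  have h0 : 0 ≤ δ * ‖p - q‖ := by positivity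
  have h1 : 0 ≤ n * ((M + 1) * δ * ‖p - q‖) := by positivity
  have h2 : δ * (n * (M + 1) + 1) * ‖p - q‖ = n * ((M + 1) * δ * ‖p - q‖) + δ * ‖p - q‖ := by ring
  rw [h2]
  refine max_le ?_ (max_le ((hL p q).trans (by linarith)) ?_)
  · simp only [horizontalLift, Prod.fst_sub, sub_self, norm_zero]
    linarith
  · simp only [horizontalLift, Prod.snd_sub]
    rw [← neg_sub', norm_neg]
    exact hsum.trans (by linarith)

/-- If `g` and `id + v` are `C`-Lipschitz perturbations of the identity, then `g ∘ (id + v)⁻¹` is a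
`4C`-Lipschitz one, because `(id + v)⁻¹` is `2`-Lipschitz. -/
theorem norm_symm_trans_sub_id_le {n : ℕ} {v : StdSpace n → StdSpace n}
    (hv : LipschitzWith (1 / 2) v) {g ψ : StdDiffeo n} (hψ : ∀ p, ψ p = p + v p) {C : ℝ}
    (hC : 0 ≤ C) (hgv : ∀ p q, ‖(g p - p) - (g q - q)‖ ≤ C * ‖p - q‖)
    (hvC : ∀ p q, ‖v p - v q‖ ≤ C * ‖p - q‖) (p q : StdSpace n) :
    ‖(ψ.symm.trans g p - p) - (ψ.symm.trans g q - q)‖ ≤ 4 * C * ‖p - q‖ := by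
  obtain ⟨a, rfl⟩ : ∃ a, ψ a = p := ⟨ψ.symm p, ψ.apply_symm_apply p⟩
  obtain ⟨b, rfl⟩ : ∃ b, ψ b = q := ⟨ψ.symm q, ψ.apply_symm_apply q⟩
  have h1 : ‖a - b‖ ≤ 2 * ‖ψ a - ψ b‖ := by
    have := (lipschitzWith_iff_norm_sub_le.mp (lipschitzWith_symm_of_id_add hv hψ)) (ψ a) (ψ b)
    simpa using this
  simp only [Diffeomorph.coe_trans, Function.comp_apply, Diffeomorph.symm_apply_apply]
  calc ‖(g a - ψ a) - (g b - ψ b)‖ = ‖((g a - a) - (g b - b)) - (v a - v b)‖ := by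
        rw [hψ, hψ]; congr 1; abel
    _ ≤ C * ‖a - b‖ + C * ‖a - b‖ := (norm_sub_le _ _).trans (add_le_add (hgv a b) (hvC a b))
    _ = 2 * C * ‖a - b‖ := by ring
    _ ≤ 2 * C * (2 * ‖ψ a - ψ b‖) := by gcongr
    _ = _ := by ring

theorem Diffeomorph.symm_trans_apply_of_fix {n : ℕ} {K : Set (StdSpace n)} {f g : StdDiffeo n}
    (hf : ∀ p ∉ K, f p = p) (hg : ∀ p ∉ K, g p = p) : ∀ p ∉ K, f.symm.trans g p = p := fun p hp => by
  simp [Diffeomorph.symm_apply_of_fix (hf p hp), hg p hp]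

/-- A diffeomorphism that is `C¹`-close to the identity and supported in `K ⊆ U` is reachable by a
null arc in `U`: it is the composition of a displacement along the horizontal fields
`∂_{yᵢ} - xᵢ ∂_z` that corrects the `y`-coordinates, one along `∂_{x₁} - ε ∂_z` that corrects
the `z`-coordinate, and one along the `x`-directions. -/
theorem exists_nullReachable_of_small {n : ℕ} (hn : 1 ≤ n) {K U : Set (StdSpace n)}
    (hK : IsCompact K) (hU : IsOpen U) (hKU : K ⊆ U) :
    ∃ δ : ℝ≥0, 0 < δ ∧ ∀ g : StdDiffeo n, (∀ p ∉ K, g p = p) → (∀ p, ‖g p - p‖ ≤ δ) →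
      LipschitzWith δ (fun p => g p - p) → NullReachable U g := by
  let i : Fin n := ⟨0, hn⟩
  obtain ⟨ε, hε, hε1, hεK⟩ := exists_nullReachable_of_oblique i hK hU hKU
  obtain ⟨M₀, hM₀⟩ := hK.isBounded.exists_norm_le
  set M := |M₀|
  have hM : ∀ p ∈ K, ‖p‖ ≤ M := fun p hp => (hM₀ p hp).trans (le_abs_self _)
  set A : ℝ := n * (M + 1) + 1 with hA
  have hM0 : 0 ≤ M := abs_nonneg _
  have hA1 : 1 ≤ A := by
    have : 0 ≤ (n : ℝ) * (M + 1) := by positivity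
    linarith
  have hA0 : 0 < A := by linarith
  set δ : ℝ := ε / (64 * A) with hδ
  have hδ0 : 0 < δ := by positivity
  have hδA : δ * A = ε / 64 := by rw [hδ]; field_simp
  refine ⟨⟨δ, hδ0.le⟩, hδ0, fun g hgK hgb hgL => ?_⟩
  replace hgL := lipschitzWith_iff_norm_sub_le.mp hgL
  replace hgb : ∀ p, ‖g p - p‖ ≤ δ := hgb
  replace hgL : ∀ p q, ‖(g p - p) - (g q - q)‖ ≤ δ * ‖p - q‖ := fun p q => hgL p q
  have hgs : ContDiff ℝ ∞ fun p => g p - p := g.contDiff.sub contDiff_id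
  have hsn : ∀ a : StdSpace n, ‖a.2.1‖ ≤ ‖a‖ := fun a => (norm_fst_le a.2).trans (norm_snd_le a)
  have hsz : ∀ a : StdSpace n, ‖a.2.2‖ ≤ ‖a‖ := fun a => (norm_snd_le a.2).trans (norm_snd_le a)
  -- the displacement of the `y`-coordinates
  set h : StdSpace n → Fin n → ℝ := fun p => (g p - p).2.1 with hh
  have hhs : ContDiff ℝ ∞ h := contDiff_fst.comp (contDiff_snd.comp hgs)
  have hhK : ∀ p ∉ K, h p = 0 := fun p hp => by simp [hh, hgK p hp]
  have hvL := norm_horizontalLift_sub_le hM0 hδ0.le hM hhK (fun p => (hsn _).trans (hgb p))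
    (fun p q => (hsn ((g p - p) - (g q - q))).trans (hgL p q))
  rw [← hA, hδA] at hvL
  have hvL' : LipschitzWith (1 / 2) (horizontalLift h) := by
    rw [lipschitzWith_iff_norm_sub_le]
    intro p q
    refine (hvL p q).trans ?_
    push_cast
    gcongr
    linarith
  have hvK : ∀ p ∉ K, horizontalLift h p = 0 := fun p hp => by
    simp only [horizontalLift, hhK p hp]
    simp
  obtain ⟨ψ, hψ⟩ := exists_diffeo_id_add hhs.horizontalLift hvL'
    (by rw [← NNReal.coe_lt_coe]; norm_num)
  have hψN : NullReachable U ψ := by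
    refine nullReachable_of_horizontal hK hKU hhs.horizontalLift hvK hvL' (fun p t => ?_) hψ
    simp [stdContactForm_apply, horizontalLift]
  have hψK : ∀ p ∉ K, ψ p = p := fun p hp => by rw [hψ, hvK p hp, add_zero]
  -- the remaining factor preserves the `y`-coordinates
  set H := ψ.symm.trans g with hH
  have hHψ : ∀ a, H (ψ a) = g a := fun a => by simp [hH]
  have hHK : ∀ p ∉ K, H p = p := Diffeomorph.symm_trans_apply_of_fix hψK hgK
  have hHy : ∀ p, (H p).2.1 = p.2.1 := by
    intro p
    obtain ⟨a, rfl⟩ : ∃ a, ψ a = p := ⟨ψ.symm p, ψ.apply_symm_apply p⟩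
    rw [hHψ, hψ]
    simp [horizontalLift, hh]
  have hHL : ∀ p q, ‖(H p - p) - (H q - q)‖ ≤ ε / 16 * ‖p - q‖ := fun p q => by
    have := norm_symm_trans_sub_id_le hvL' hψ (by positivity) (fun p q => (hgL p q).trans (by
      gcongr
      calc δ = δ * 1 := (mul_one _).symm
        _ ≤ δ * A := by gcongr
        _ = ε / 64 := hδA)) hvL p q
    calc _ ≤ 4 * (ε / 64) * ‖p - q‖ := this
      _ = _ := by ring
  have hHs : ContDiff ℝ ∞ fun p => H p - p := H.contDiff.sub contDiff_id
  -- the displacement of the `z`-coordinate, measured along `∂_{x₁} - ε ∂_z`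
  set κ : StdSpace n → ℝ := fun p => -(1 / ε) * (H p - p).2.2 with hκ
  have hκs : ContDiff ℝ ∞ κ := contDiff_const.mul (contDiff_snd.comp (contDiff_snd.comp hHs))
  have hκK : ∀ p ∉ K, κ p = 0 := fun p hp => by simp [hκ, hHK p hp]
  have hκL : ∀ p q, ‖κ p - κ q‖ ≤ 1 / 16 * ‖p - q‖ := fun p q => by
    have h1 : κ p - κ q = -(1 / ε) * ((H p - p) - (H q - q)).2.2 := by
      simp only [hκ, Prod.snd_sub]; ring
    rw [h1, norm_mul, norm_neg, Real.norm_of_nonneg (by positivity)]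
    calc _ ≤ 1 / ε * (ε / 16 * ‖p - q‖) := by gcongr; exact (hsz _).trans (hHL p q)
      _ = _ := by field_simp
  set w : StdSpace n := (Pi.single i 1, 0, -ε) with hw
  have hwn : ‖w‖ ≤ 1 := by
    simp only [hw, Prod.norm_mk, norm_zero, norm_neg, Real.norm_of_nonneg hε.le]
    exact max_le (by rw [Pi.norm_single, norm_one]) (max_le zero_le_one hε1)
  have hκwL : ∀ p q, ‖κ p • w - κ q • w‖ ≤ 1 / 16 * ‖p - q‖ := fun p q => by
    rw [← sub_smul, norm_smul]
    calc _ ≤ (1 / 16 * ‖p - q‖) * 1 := by gcongr; exact hκL p q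
      _ = _ := mul_one _
  have hκwL' : LipschitzWith (1 / 2) fun p => κ p • w := by
    rw [lipschitzWith_iff_norm_sub_le]
    intro p q
    refine (hκwL p q).trans ?_
    push_cast
    gcongr
    norm_num
  obtain ⟨Θ, hΘ⟩ := exists_diffeo_id_add (v := fun p => κ p • w) (hκs.smul contDiff_const) hκwL'
    (by rw [← NNReal.coe_lt_coe]; norm_num)
  have hΘN : NullReachable U Θ := by
    refine hεK κ hκs hκK ?_ Θ hΘ
    rw [lipschitzWith_iff_norm_sub_le]
    intro p q
    refine (hκL p q).trans ?_
    push_cast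
    gcongr
    norm_num
  have hΘK : ∀ p ∉ K, Θ p = p := fun p hp => by rw [hΘ, hκK p hp, zero_smul, add_zero]
  -- what is left is a displacement of the `x`-coordinates
  set X := Θ.symm.trans H with hX
  have hXΘ : ∀ a, X (Θ a) = H a := fun a => by simp [hX]
  have hXK : ∀ p ∉ K, X p = p := Diffeomorph.symm_trans_apply_of_fix hΘK hHK
  have hXyz : ∀ p, (X p).2 = p.2 := by
    intro p
    obtain ⟨a, rfl⟩ : ∃ a, Θ a = p := ⟨Θ.symm p, Θ.apply_symm_apply p⟩
    rw [hXΘ, hΘ]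
    ext
    · simp [hHy, hw]
    · simp only [hκ, hw, Prod.snd_add, Prod.snd_sub, Prod.smul_snd, smul_eq_mul]
      field_simp
      ring
  have hXL : LipschitzWith (1 / 2) fun p => X p - p := by
    rw [lipschitzWith_iff_norm_sub_le]
    intro p q
    have := norm_symm_trans_sub_id_le (C := 1 / 16) hκwL' hΘ (by norm_num)
      (fun p q => (hHL p q).trans (by gcongr)) hκwL p q
    refine this.trans ?_
    push_cast
    gcongr
    norm_num
  have hXN : NullReachable U X := by
    refine nullReachable_of_horizontal hK hKU (v := fun p => X p - p)
      (X.contDiff.sub contDiff_id) (fun p hp => by rw [hXK p hp, sub_self]) hXL (fun p t => ?_)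
      (fun p => by abel)
    have : (X p - p).2 = 0 := by rw [Prod.snd_sub, hXyz, sub_self]
    simp [stdContactForm_apply, this]
  have hfin : g = ψ.trans (Θ.trans X) := by
    ext1 p
    simp only [Diffeomorph.coe_trans, Function.comp_apply]
    rw [hXΘ, hHψ]
  rw [hfin]
  exact hψN.trans (hΘN.trans hXN)

/-- The end of a smooth isotopy with compact support in an open set `U` is reachable by a null arc
in `U`: the relation `F s ∘ (F t)⁻¹ ∈ NullReachable U` between parameters `s` and `t` is an
equivalence relation with open classes. -/
theorem nullReachable_of_isotopy {n : ℕ} (hn : 1 ≤ n) {K U : Set (StdSpace n)}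
    (hK : IsCompact K) (hU : IsOpen U) (hKU : K ⊆ U) {F : ℝ → StdDiffeo n} (hF : IsSmoothFamily F)
    (hFK : ∀ t, ∀ p ∉ K, F t p = p) (h0 : ∀ p, F 0 p = p) : NullReachable U (F 1) := by
  obtain ⟨δ, hδ, hδK⟩ := exists_nullReachable_of_small hn hK hU hKU
  have key : NullReachable U ((F 0).symm.trans (F 1)) := by
    refine isPreconnected_univ.induction₂ (fun s t => NullReachable U ((F s).symm.trans (F t)))
      (fun t _ => ?_) (fun r s t _ _ _ h1 h2 => ?_) (fun s t _ _ h1 => ?_)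
      (mem_univ (0 : ℝ)) (mem_univ (1 : ℝ))
    · rw [nhdsWithin_univ]
      have hV : ContDiff ℝ ∞ fun q : ℝ × StdSpace n => F q.1 ((F t).symm q.2) - q.2 :=
        ContDiff.sub ((IsSmoothFamily.const (F t).symm).trans hF) contDiff_snd
      have hVK : ∀ s, ∀ p ∉ K, F s ((F t).symm p) - p = 0 := fun s p hp => by
        rw [Diffeomorph.symm_apply_of_fix (hFK t p hp), hFK s p hp, sub_self]
      filter_upwards [eventually_small_of_eq_zero hV hK hVK (t₀ := t) (fun p => by simp) hδ] with s hs
      exact hδK _ (fun p hp => sub_eq_zero.mp (hVK s p hp)) hs.1 hs.2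
    · have h3 : (F r).symm.trans (F t) =
          ((F r).symm.trans (F s)).trans ((F s).symm.trans (F t)) := by ext1 p; simp
      rw [h3]
      exact h1.trans h2
    · have h3 : (F t).symm.trans (F s) = ((F s).symm.trans (F t)).symm := by
        rw [Diffeomorph.symm_trans']; rfl
      rw [h3]
      exact h1.symm
  have h1 : (F 0).symm.trans (F 1) = F 1 := by
    ext1 p; simp [Diffeomorph.symm_apply_of_fix (h0 p)]
  rwa [h1] at key

/-! ### Cutting off isotopies -/

/-- `f` is joined to the identity by a smooth family that fixes the points of `S`. -/
def IsotopicToIdRel {n : ℕ} (S : Set (StdSpace n)) (f : StdDiffeo n) : Prop :=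
  ∃ F : ℝ → StdDiffeo n, IsSmoothFamily F ∧ (∀ p, F 0 p = p) ∧ (∀ p, F 1 p = f p) ∧
    ∀ t, ∀ p ∈ S, F t p = p

namespace IsotopicToIdRel

variable {n : ℕ} {S T : Set (StdSpace n)} {f g : StdDiffeo n}

theorem apply_eq (hf : IsotopicToIdRel S f) {p : StdSpace n} (hp : p ∈ S) : f p = p := by
  obtain ⟨F, -, -, h1, h⟩ := hf
  rw [← h1, h 1 p hp]

theorem mono (hf : IsotopicToIdRel S f) (h : T ⊆ S) : IsotopicToIdRel T f := by
  obtain ⟨F, hF, h0, h1, hS⟩ := hf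
  exact ⟨F, hF, h0, h1, fun t p hp => hS t p (h hp)⟩

theorem trans (hf : IsotopicToIdRel S f) (hg : IsotopicToIdRel S g) :
    IsotopicToIdRel S (f.trans g) := by
  obtain ⟨F, hF, hF0, hF1, hFS⟩ := hf
  obtain ⟨G, hG, hG0, hG1, hGS⟩ := hg
  exact ⟨_, hF.trans hG, fun p => by simp [hF0, hG0], fun p => by simp [hF1, hG1],
    fun t p hp => by simp [hFS t p hp, hGS t p hp]⟩

theorem symm (hf : IsotopicToIdRel S f) : IsotopicToIdRel S f.symm := by
  obtain ⟨F, hF, hF0, hF1, hFS⟩ := hf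
  refine ⟨_, hF.symm, fun p => Diffeomorph.symm_apply_of_fix (hF0 p), fun p => ?_,
    fun t p hp => Diffeomorph.symm_apply_of_fix (hFS t p hp)⟩
  rw [show F 1 = f from Diffeomorph.ext hF1]

theorem conj (hf : IsotopicToIdRel S f) (c : StdDiffeo n) (h : ∀ p ∈ T, c p ∈ S) :
    IsotopicToIdRel T (c.trans (f.trans c.symm)) := by
  obtain ⟨F, hF, hF0, hF1, hFS⟩ := hf
  exact ⟨_, (IsSmoothFamily.const c).trans (hF.trans (IsSmoothFamily.const c.symm)),
    fun p => by simp [hF0], fun p => by simp [hF1], fun t p hp => by simp [hFS t _ (h p hp)]⟩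

end IsotopicToIdRel

/-- Near a parameter `t`, the isotopy `F s ∘ (F t)⁻¹` can be cut off outside of the compact set
swept out by `B`: the cut-off is a small perturbation of the identity, hence an isotopy. -/
theorem eventually_exists_cutoff_isotopy {n : ℕ} {F : ℝ → StdDiffeo n} (hF : IsSmoothFamily F)
    {A B : Set (StdSpace n)} (hB : IsCompact B) (hA : ∀ t, ∀ p ∈ A, F t p = p) {t : ℝ}
    (ht : t ∈ Icc (0 : ℝ) 1) :
    ∀ᶠ s in 𝓝[Icc 0 1] t, ∃ c i : StdDiffeo n, (F t).symm.trans (F s) = i.trans c ∧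
      (∃ K, IsCompact K ∧ IsotopicToIdRel (Kᶜ ∪ A) c) ∧ IsotopicToIdRel (F t '' B) i := by
  set Q : Set (StdSpace n) := (fun q : ℝ × StdSpace n => F q.1 q.2) '' (Icc 0 1 ×ˢ B) with hQ
  have hQc : IsCompact Q := (isCompact_Icc.prod hB).image (ContDiff.continuous hF)
  have hQm : ∀ s ∈ Icc (0 : ℝ) 1, ∀ b ∈ B, F s b ∈ Q := fun s hs b hb => ⟨(s, b), ⟨hs, hb⟩, rfl⟩
  obtain ⟨χ, L, hχ, hL, -, hχ1, hχ0⟩ := exists_smooth_cutoff hQc isOpen_univ (subset_univ Q)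
  set V : ℝ × StdSpace n → StdSpace n := fun q => χ q.2 • (F q.1 ((F t).symm q.2) - q.2) with hVdef
  have hV : ContDiff ℝ ∞ V := (hχ.comp contDiff_snd).smul
    (ContDiff.sub ((IsSmoothFamily.const (F t).symm).trans hF) contDiff_snd)
  have hVL : ∀ s, ∀ p ∉ L, V (s, p) = 0 := fun s p hp => by simp [hVdef, hχ0 p hp]
  have hVt : ∀ p, V (t, p) = 0 := fun p => by simp [hVdef]
  have hVA : ∀ s, ∀ p ∈ A, V (s, p) = 0 := fun s p hp => by
    simp [hVdef, Diffeomorph.symm_apply_of_fix (hA t p hp), hA s p hp]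
  have hVB : ∀ s, ∀ b ∈ B, F t b + V (s, F t b) = F s b := fun s b hb => by
    simp [hVdef, hχ1 _ (hQm t ht b hb)]
  have hsmall := eventually_small_of_eq_zero hV hL hVL hVt (δ := 1 / 2)
    (by rw [← NNReal.coe_lt_coe]; norm_num)
  obtain ⟨η, hη, hηV⟩ := Metric.eventually_nhds_iff.mp hsmall
  filter_upwards [mem_nhdsWithin_of_mem_nhds (Metric.ball_mem_nhds t hη)] with s hs
  -- the parameter runs from `t` to `s`
  set u : ℝ → ℝ := fun τ => t + smoothStep τ * (s - t) with hu
  have hus : ContDiff ℝ ∞ u := contDiff_const.add (contDiff_smoothStep.mul contDiff_const)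
  have hu0 : u 0 = t := by simp [hu, smoothStep_of_le (show (0 : ℝ) ≤ 1 / 3 by norm_num)]
  have hu1 : u 1 = s := by simp [hu, smoothStep_of_ge (show (2 / 3 : ℝ) ≤ 1 by norm_num)]
  have hud : ∀ τ, dist (u τ) t < η := fun τ => by
    rw [Real.dist_eq, hu, add_sub_cancel_left, abs_mul, abs_of_nonneg (smoothStep_nonneg τ)]
    refine (mul_le_of_le_one_left (abs_nonneg _) (smoothStep_le_one τ)).trans_lt ?_
    rwa [← Real.dist_eq]
  have hex : ∀ τ, ∃ g : StdDiffeo n, ∀ p, g p = p + V (u τ, p) := fun τ =>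
    exists_diffeo_id_add (hV.comp (contDiff_const.prodMk contDiff_id)) (hηV (hud τ)).2
      (by rw [← NNReal.coe_lt_coe]; norm_num)
  choose C hC using hex
  have hCs : IsSmoothFamily C := by
    simp only [IsSmoothFamily, hC]
    exact contDiff_snd.add (hV.comp ((hus.comp contDiff_fst).prodMk contDiff_snd))
  have hCB : ∀ τ, ∀ b ∈ B, C τ (F t b) = F (u τ) b := fun τ b hb => by rw [hC, hVB _ b hb]
  refine ⟨C 1, ((F t).symm.trans (F s)).trans (C 1).symm, ?_, ⟨L, hL, C, hCs, fun p => ?_,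
    fun p => rfl, fun τ p hp => ?_⟩, fun τ => ((F t).symm.trans (F (u τ))).trans (C τ).symm,
    ((IsSmoothFamily.const (F t).symm).trans (hF.reparam hus)).trans hCs.symm, fun p => ?_,
    fun p => by simp [hu1], ?_⟩
  · ext1 p; simp
  · rw [hC, hu0, hVt, add_zero]
  · rcases hp with hp | hp
    · rw [hC, hVL _ p hp, add_zero]
    · rw [hC, hVA _ p hp, add_zero]
  · have h0 : C 0 p = p := by rw [hC, hu0, hVt, add_zero]
    simp [hu0, Diffeomorph.symm_apply_of_fix h0]
  · rintro τ _ ⟨b, hb, rfl⟩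
    simp only [Diffeomorph.coe_trans, Function.comp_apply, Diffeomorph.symm_apply_apply]
    rw [← hCB τ b hb, Diffeomorph.symm_apply_apply]

/-- Isotopy extension: a diffeomorphism isotopic to the identity, fixing `A`, is the
composition of one that is compactly isotopic to the identity, fixing `A`, and of one that
is isotopic to the identity fixing a given compact set `B`. -/
theorem IsotopicToIdRel.exists_eq_trans {n : ℕ} {A B : Set (StdSpace n)} (hB : IsCompact B)
    {f : StdDiffeo n} (hf : IsotopicToIdRel A f) :
    ∃ c i : StdDiffeo n, f = i.trans c ∧ (∃ K, IsCompact K ∧ IsotopicToIdRel (Kᶜ ∪ A) c) ∧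
      IsotopicToIdRel B i := by
  obtain ⟨F, hF, hF0, hF1, hFA⟩ := hf
  have key := isPreconnected_Icc.induction₂ (s := Icc (0 : ℝ) 1) (fun s t => ∃ c i : StdDiffeo n,
      (F s).symm.trans (F t) = i.trans c ∧
      (∃ K, IsCompact K ∧ IsotopicToIdRel (Kᶜ ∪ A) c) ∧ IsotopicToIdRel (F s '' B) i)
    (fun t ht => eventually_exists_cutoff_isotopy hF hB hFA ht) ?_ ?_
    (left_mem_Icc.mpr zero_le_one) (right_mem_Icc.mpr zero_le_one)
  · obtain ⟨c, i, h, hc, hi⟩ := key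
    refine ⟨c, i, ?_, hc, hi.mono fun p hp => ⟨p, hp, hF0 p⟩⟩
    rw [← h]
    ext1 p
    simp [Diffeomorph.symm_apply_of_fix (hF0 p), hF1]
  · -- `(c' i') (c i) = (c' c) ((c⁻¹ i' c) i)`
    rintro r s t - - - ⟨c, i, h, ⟨K, hK, hc⟩, hi⟩ ⟨c', i', h', ⟨K', hK', hc'⟩, hi'⟩
    have hcF : ∀ b ∈ B, c (F r b) = F s b := fun b hb => by
      have := DFunLike.congr_fun h (F r b)
      simpa [hi.apply_eq (mem_image_of_mem _ hb)] using this.symm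
    refine ⟨c.trans c', i.trans (c.trans (i'.trans c.symm)), ?_, ⟨K ∪ K', hK.union hK',
      (hc.mono ?_).trans (hc'.mono ?_)⟩, hi.trans (hi'.conj c ?_)⟩
    · have h3 : (F r).symm.trans (F t) =
          ((F r).symm.trans (F s)).trans ((F s).symm.trans (F t)) := by ext1 p; simp
      rw [h3, h, h']
      ext1 p; simp
    · rw [compl_union]; exact union_subset_union_left _ inter_subset_left
    · rw [compl_union]; exact union_subset_union_left _ inter_subset_right
    · rintro _ ⟨b, hb, rfl⟩
      exact ⟨b, hb, (hcF b hb).symm⟩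
  · -- `(c i)⁻¹ = c⁻¹ (c i⁻¹ c⁻¹)`
    rintro s t - - ⟨c, i, h, ⟨K, hK, hc⟩, hi⟩
    have hcF : ∀ b ∈ B, c (F s b) = F t b := fun b hb => by
      have := DFunLike.congr_fun h (F s b)
      simpa [hi.apply_eq (mem_image_of_mem _ hb)] using this.symm
    refine ⟨c.symm, c.symm.trans (i.symm.trans c), ?_, ⟨K, hK, hc.symm⟩, hi.symm.conj c.symm ?_⟩
    · have h3 : (F t).symm.trans (F s) = ((F s).symm.trans (F t)).symm := by
        rw [Diffeomorph.symm_trans']; rfl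
      rw [h3, h]
      ext1 p
      simp [Diffeomorph.symm_trans']
    · rintro _ ⟨b, hb, rfl⟩
      exact ⟨b, hb, by rw [← hcF b hb, Diffeomorph.symm_apply_apply]⟩

/-- If `f` is isotopic to the identity fixing `A`, then a null arc with compact support away
from a set `A'` in the interior of `A` moves `f` into the diffeomorphisms that are isotopic to the
identity fixing a given compact set `B`. -/
theorem IsotopicToIdRel.exists_nullReachable {n : ℕ} (hn : 1 ≤ n) {A A' B : Set (StdSpace n)}
    (hA' : IsClosed A') (hAA' : A' ⊆ interior A) (hB : IsCompact B) {f : StdDiffeo n}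
    (hf : IsotopicToIdRel A f) :
    ∃ d : StdDiffeo n, NullReachable A'ᶜ d ∧ IsotopicToIdRel B (f.trans d) := by
  obtain ⟨c, i, rfl, ⟨K, hK, C, hC, hC0, hC1, hCK⟩, hi⟩ := hf.exists_eq_trans hB
  refine ⟨c.symm, NullReachable.symm ?_, ?_⟩
  · rw [← show C 1 = c from Diffeomorph.ext hC1]
    refine nullReachable_of_isotopy hn (K := K \ interior A) (hK.diff isOpen_interior)
      hA'.isOpen_compl (fun p hp h => hp.2 (hAA' h)) hC (fun t p hp => hCK t p ?_) hC0
    rw [Set.mem_sdiff, not_and_not_right] at hp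
    by_cases h : p ∈ K
    · exact Or.inr (interior_subset (hp h))
    · exact Or.inl h
  · have h1 : (i.trans c).trans c.symm = i := by ext1 p; simp
    rwa [h1]

/-! ### Infinite concatenations -/

/-- The affine map with `1 - 2⁻ᵏ ↦ 0` and `1 - 2⁻ᵏ⁻¹ ↦ 1`, which rescales the time of the `k`-th
stage of an infinite concatenation to `[0, 1]`. -/
noncomputable def stageTime (k : ℕ) (t : ℝ) : ℝ := 2 ^ (k + 1) * (t - 1) + 2

theorem contDiff_stageTime (k : ℕ) : ContDiff ℝ ∞ (stageTime k) := by
  unfold stageTime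
  fun_prop

theorem stageTime_succ (k : ℕ) (t : ℝ) : stageTime (k + 1) t = 2 * stageTime k t - 2 := by
  unfold stageTime
  ring

theorem one_le_stageTime {j k : ℕ} (hjk : j < k) {t : ℝ} (h : 0 ≤ stageTime k t) :
    1 ≤ stageTime j t := by
  induction k, hjk using Nat.le_induction with
  | base => rw [stageTime_succ] at h; linarith
  | succ k _ ih => rw [stageTime_succ] at h; exact ih (by linarith)

theorem stageTime_nonpos (k : ℕ) {t : ℝ} (ht : t ≤ 0) : stageTime k t ≤ 0 := by
  have h1 : (1 : ℝ) ≤ 2 ^ k := one_le_pow₀ (by norm_num)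
  unfold stageTime
  rw [pow_succ]
  nlinarith

theorem exists_stageTime_le {t : ℝ} (ht : t < 1) : ∃ N, ∀ m ≥ N, stageTime m t ≤ 1 / 3 := by
  obtain ⟨N, hN⟩ := pow_unbounded_of_one_lt (2 / (1 - t)) (by norm_num : (1 : ℝ) < 2)
  refine ⟨N, fun m hm => ?_⟩
  have h1 : 0 < 1 - t := by linarith
  rw [div_lt_iff₀ h1] at hN
  have h2 : (2 : ℝ) ^ N ≤ 2 ^ (m + 1) := pow_le_pow_right₀ (by norm_num) (by omega)
  unfold stageTime
  nlinarith

section Concatenation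

variable {n : ℕ} (F : ℕ → ℝ → StdDiffeo n) (d : ℕ → StdDiffeo n)

/-- The composition `d (k - 1) ∘ ⋯ ∘ d 0`. -/
noncomputable def iterTrans : ℕ → StdDiffeo n
  | 0 => Diffeomorph.refl _ _ _
  | k + 1 => (iterTrans k).trans (d k)

/-- The concatenation of `F 0, …, F (k - 1)`, where `F j` runs while `t` goes from `1 - 2⁻ʲ` to
`1 - 2⁻ʲ⁻¹`. -/
noncomputable def iterConcat : ℕ → ℝ → StdDiffeo n
  | 0 => fun _ => Diffeomorph.refl _ _ _
  | k + 1 => fun t => (iterConcat k t).trans (F k (stageTime k t))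

variable {F d}

theorem iterConcat_finish (hF : ∀ k, IsNullArc (F k) (d k))
    {k : ℕ} {t : ℝ} (ht : ∀ j < k, 2 / 3 ≤ stageTime j t) (p : StdSpace n) :
    iterConcat F k t p = iterTrans d k p := by
  induction k with
  | zero => rfl
  | succ k ih =>
    simp only [iterConcat, iterTrans, Diffeomorph.coe_trans, Function.comp_apply]
    rw [ih fun j hj => ht j (hj.trans k.lt_succ_self), (hF k).finish _ (ht k k.lt_succ_self)]

theorem iterConcat_start (hF : ∀ k, IsNullArc (F k) (d k))
    (k : ℕ) {t : ℝ} (ht : t ≤ 0) (p : StdSpace n) :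
    iterConcat F k t p = p := by
  induction k with
  | zero => rfl
  | succ k ih =>
    simp only [iterConcat, Diffeomorph.coe_trans, Function.comp_apply]
    rw [ih, (hF k).start _ ((stageTime_nonpos k ht).trans (by norm_num))]

theorem isNullFamily_iterConcat (hF : ∀ k, IsNullArc (F k) (d k))
    (k : ℕ) : IsNullFamily (iterConcat F k) := by
  induction k with
  | zero => exact IsNullFamily.refl
  | succ k ih =>
    refine ih.trans ((hF k).reparam (contDiff_stageTime k)) fun t => ?_
    have hc : Continuous (stageTime k) := (contDiff_stageTime k).continuous
    rcases lt_or_ge (stageTime k t) (1 / 3) with h | h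
    · left
      filter_upwards [hc.continuousAt.eventually_lt_const h] with s hs using (hF k).start _ hs.le
    · refine Or.inr ⟨iterTrans d k, ?_⟩
      filter_upwards [hc.continuousAt.eventually_const_lt (show 0 < stageTime k t by linarith)]
        with s hs
      exact iterConcat_finish hF fun j hj => by linarith [one_le_stageTime hj hs.le]

theorem iterConcat_eq_of_stageTime_le (hF : ∀ k, IsNullArc (F k) (d k))
    {N m : ℕ} (hNm : N ≤ m) {t : ℝ}
    (ht : ∀ j ≥ N, stageTime j t ≤ 1 / 3) (p : StdSpace n) :
    iterConcat F m t p = iterConcat F N t p := by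
  induction m, hNm using Nat.le_induction with
  | base => rfl
  | succ m hm ih =>
    simp only [iterConcat, Diffeomorph.coe_trans, Function.comp_apply]
    rw [(hF m).start _ (ht m hm), ih]

/-- A point that has reached `A k` after the first `k` stages is not moved any more. -/
theorem iterConcat_eq_of_mem (hF : ∀ k, IsNullArc (F k) (d k))
    {A : ℕ → Set (StdSpace n)} (hA : Monotone A)
    (hFA : ∀ k t, ∀ p ∈ A k, F k t p = p) {k m : ℕ} (hkm : k ≤ m) {p : StdSpace n}
    (hp : ∀ j ≥ k, iterTrans d j p = iterTrans d k p) (hpk : iterTrans d k p ∈ A k) (t : ℝ) :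
    iterConcat F m t p = iterConcat F k t p := by
  induction m, hkm using Nat.le_induction with
  | base => rfl
  | succ m hm ih =>
    simp only [iterConcat, Diffeomorph.coe_trans, Function.comp_apply]
    rw [← ih]
    rcases le_total (stageTime m t) (1 / 3) with h | h
    · rw [(hF m).start _ h]
    · rw [iterConcat_finish hF (fun j hj => by
        linarith [one_le_stageTime hj (show 0 ≤ stageTime m t by linarith)])]
      exact hFA m _ _ (by rw [hp m hm]; exact hA hm hpk)

/-- An infinite concatenation of null arcs, running on the intervals `[1 - 2⁻ᵏ, 1 - 2⁻ᵏ⁻¹]`, is a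
null family up to and beyond the time `1` if every point is eventually not moved any more, locally
uniformly. -/
theorem exists_nullFamily_of_infinite_concatenation (hF : ∀ k, IsNullArc (F k) (d k))
    {A : ℕ → Set (StdSpace n)} (hA : Monotone A)
    (hAn : ∀ p, ∃ k, A k ∈ 𝓝 p) (hFA : ∀ k t, ∀ p ∈ A k, F k t p = p) (f : StdDiffeo n)
    (hf : ∀ k p, f p ∈ A k → iterTrans d k p = f p) :
    ∃ H : ℝ → StdDiffeo n, IsNullFamily H ∧ (∀ t ≤ 0, ∀ p, H t p = p) ∧
      ∀ t ≥ 1, ∀ p, H t p = f p := by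
  have hmem : ∀ k p, f p ∈ A k → ∀ m ≥ k, ∀ t, iterConcat F m t p = iterConcat F k t p :=
    fun k p hp m hm t => iterConcat_eq_of_mem hF hA hFA hm
      (fun j hj => by rw [hf k p hp, hf j p (hA hj hp)]) (by rwa [hf k p hp]) t
  have hex : ∀ t : ℝ, ∃ g : StdDiffeo n, ∀ k p, f p ∈ A k → g p = iterConcat F k t p := by
    intro t
    rcases lt_or_ge t 1 with ht | ht
    · obtain ⟨N, hN⟩ := exists_stageTime_le ht
      refine ⟨iterConcat F N t, fun k p hp => ?_⟩
      rcases le_total k N with h | h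
      · exact hmem k p hp N h t
      · exact (iterConcat_eq_of_stageTime_le hF h hN p).symm
    · refine ⟨f, fun k p hp => ?_⟩
      rw [iterConcat_finish hF (fun j _ => ?_), hf k p hp]
      have : 0 ≤ (2 : ℝ) ^ (j + 1) * (t - 1) := mul_nonneg (by positivity) (by linarith)
      unfold stageTime
      linarith
  choose H hH using hex
  have hcov : ∀ p, ∃ k, ∀ᶠ q in 𝓝 p, ∀ t, H t q = iterConcat F k t q := by
    intro p
    obtain ⟨k, hk⟩ := hAn (f p)
    refine ⟨k, ?_⟩
    filter_upwards [f.continuous.continuousAt.eventually hk] with q hq t using hH t k q hq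
  refine ⟨H, ⟨?_, fun t p => ?_⟩, fun t ht p => ?_, fun t ht p => ?_⟩
  · rw [IsSmoothFamily, contDiff_iff_contDiffAt]
    rintro ⟨t, p⟩
    obtain ⟨k, hk⟩ := hcov p
    refine (ContDiff.contDiffAt (isNullFamily_iterConcat hF k).smooth).congr_of_eventuallyEq ?_
    have : Tendsto Prod.snd (𝓝 (t, p)) (𝓝 p) := continuous_snd.continuousAt
    filter_upwards [this.eventually hk] with q hq using hq q.1
  · obtain ⟨k, hk⟩ := hcov p
    have h := hk.self_of_nhds
    simp only [h]
    exact (isNullFamily_iterConcat hF k).null t p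
  · obtain ⟨k, hk⟩ := hcov p
    rw [hk.self_of_nhds, iterConcat_start hF k ht]
  · obtain ⟨k, hk⟩ := hAn (f p)
    rw [hH t k p (mem_of_mem_nhds hk), iterConcat_finish hF (fun j _ => ?_),
      hf k p (mem_of_mem_nhds hk)]
    have : 0 ≤ (2 : ℝ) ^ (j + 1) * (t - 1) := mul_nonneg (by positivity) (by linarith)
    unfold stageTime
    linarith

end Concatenation

/-- Every diffeomorphism that is smoothly isotopic to the identity is the end of a null family. -/
theorem IsotopicToIdRel.exists_nullFamily {n : ℕ} (hn : 1 ≤ n) {f : StdDiffeo n}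
    (hf : IsotopicToIdRel ∅ f) : ∃ H : ℝ → StdDiffeo n, IsNullFamily H ∧
      (∀ t ≤ 0, ∀ p, H t p = p) ∧ ∀ t ≥ 1, ∀ p, H t p = f p := by
  -- `B 0` is empty and the balls `B k` exhaust the space
  set B : ℕ → Set (StdSpace n) := fun k => Metric.closedBall 0 (k - 1) with hB
  set A : ℕ → Set (StdSpace n) := fun k => Metric.closedBall 0 (k - 2) with hA
  have hAB : ∀ k, A k ⊆ interior (B k) := fun k =>
    (Metric.closedBall_subset_ball (by linarith)).trans Metric.ball_subset_interior_closedBall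
  have hBc : ∀ k, IsCompact (B k) := fun k => isCompact_closedBall _ _
  have hstep : ∀ k, ∀ g : StdDiffeo n, IsotopicToIdRel (B k) g →
      ∃ d : StdDiffeo n, NullReachable (A k)ᶜ d ∧ IsotopicToIdRel (B (k + 1)) (g.trans d) :=
    fun k g hg => hg.exists_nullReachable hn Metric.isClosed_closedBall (hAB k) (hBc _)
  choose! D hD hDg using hstep
  let g : ℕ → StdDiffeo n := fun k => Nat.rec f.symm (fun k g => g.trans (D k g)) k
  have hg : ∀ k, IsotopicToIdRel (B k) (g k) := by
    intro k
    induction k with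
    | zero =>
      refine hf.symm.mono ?_
      rw [hB]
      simp
    | succ k ih => exact hDg k _ ih
  have hgd : ∀ k, f.trans (g k) = iterTrans (fun k => D k (g k)) k := by
    intro k
    induction k with
    | zero => ext1 p; simp [g, iterTrans]
    | succ k ih =>
      rw [iterTrans, ← ih]
      rfl
  choose F K hF hK hKA hFK using fun k => hD k (g k) (hg k)
  refine exists_nullFamily_of_infinite_concatenation hF (A := A) ?_ ?_ ?_ f ?_
  · exact fun j k hjk => Metric.closedBall_subset_closedBall (by gcongr)
  · intro p
    obtain ⟨k, hk⟩ := exists_nat_gt (‖p‖ + 2)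
    refine ⟨k, Metric.closedBall_mem_nhds_of_mem ?_⟩
    rw [mem_ball_zero_iff]
    linarith
  · exact fun k t p hp => hFK k t p fun h => hKA k h hp
  · intro k p hp
    rw [← hgd]
    exact (hg k).apply_eq (interior_subset (hAB k hp))

/-! ### From smooth paths to smooth families and back -/

/-- Reparametrizing by `smoothStep`, whose values are in `[0, 1]`, extends a path smoothly to all
parameters `t ∈ ℝ`. -/
theorem IsDiffeoPathTo.isSmoothFamily_reparam {n : ℕ} {F : ℝ → StdDiffeo n} {f : StdDiffeo n}
    (hF : IsDiffeoPathTo F f) : IsSmoothFamily fun t => F (smoothStep t) :=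
  hF.1.comp_contDiff (f := fun q : ℝ × StdSpace n => (smoothStep q.1, q.2))
    ((contDiff_smoothStep.comp contDiff_fst).prodMk contDiff_snd)
    fun q => ⟨⟨smoothStep_nonneg q.1, smoothStep_le_one q.1⟩, mem_univ _⟩

theorem IsDiffeoPathTo.isotopicToIdRel {n : ℕ} {F : ℝ → StdDiffeo n} {f : StdDiffeo n}
    (hF : IsDiffeoPathTo F f) {S : Set (StdSpace n)}
    (hS : ∀ t ∈ Icc (0 : ℝ) 1, ∀ p ∈ S, F t p = p) : IsotopicToIdRel S f := by
  refine ⟨_, hF.isSmoothFamily_reparam, fun p => ?_, fun p => ?_,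
    fun t p hp => hS _ ⟨smoothStep_nonneg t, smoothStep_le_one t⟩ p hp⟩
  · rw [smoothStep_of_le (by norm_num), hF.2.1]
  · rw [smoothStep_of_ge (by norm_num), hF.2.2]

namespace IsSmoothFamily

variable {n : ℕ} {F : ℝ → StdDiffeo n}

theorem isDiffeoPathTo (hF : IsSmoothFamily F) {f : StdDiffeo n} (h0 : ∀ p, F 0 p = p)
    (h1 : ∀ p, F 1 p = f p) : IsDiffeoPathTo F f :=
  ⟨ContDiff.contDiffOn hF, h0, h1⟩

theorem hasDerivAt_curve (hF : IsSmoothFamily F) (t : ℝ) (p : StdSpace n) :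
    HasDerivAt (fun s => F s p) (deriv (fun s => F s p) t) t :=
  ((hF.contDiff_curve p).differentiable (by simp) t).hasDerivAt

theorem pathVelocity_eq_deriv (hF : IsSmoothFamily F) {t : ℝ} (ht : t ∈ Icc (0 : ℝ) 1)
    (p : StdSpace n) : pathVelocity F t p = deriv (fun s => F s p) t :=
  (hF.hasDerivAt_curve t p).differentiableAt.derivWithin
    (uniqueDiffOn_Icc zero_lt_one t ht)

end IsSmoothFamily

theorem IsNullFamily.isNullPath {n : ℕ} {F : ℝ → StdDiffeo n} (hF : IsNullFamily F) :
    IsNullPath F := fun t ht p => by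
  rw [hF.smooth.pathVelocity_eq_deriv ht]
  exact LinearMap.mem_ker.mpr (hF.null t p)

/-! ### The Reeb flow and positive paths -/

/-- The flow for time `s` of the Reeb vector field `∂_z`. -/
noncomputable def reebFlow (n : ℕ) (s : ℝ) : StdDiffeo n where
  toEquiv := Equiv.addRight (0, 0, s)
  contMDiff_toFun := (contDiff_id.add contDiff_const).contMDiff
  contMDiff_invFun := (contDiff_id.add contDiff_const).contMDiff

theorem reebFlow_apply {n : ℕ} (s : ℝ) (p : StdSpace n) : reebFlow n s p = p + (0, 0, s) := rfl

theorem isSmoothFamily_reebFlow (n : ℕ) : IsSmoothFamily (reebFlow n) :=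
  contDiff_snd.add (contDiff_const.prodMk (contDiff_const.prodMk contDiff_fst))

/-- The Reeb flow preserves the contact form, so that composing a null family with it adds a
positive constant to the value of the contact form on the velocity. -/
theorem IsNullFamily.isPositivePath_trans_reebFlow {n : ℕ} {F : ℝ → StdDiffeo n}
    (hF : IsNullFamily F) {c : ℝ} (hc : 0 < c) :
    IsSmoothFamily (fun t => (F t).trans (reebFlow n (c * t))) ∧
      IsPositivePath fun t => (F t).trans (reebFlow n (c * t)) := by
  have hs : IsSmoothFamily (fun t => (F t).trans (reebFlow n (c * t))) :=
    hF.smooth.trans ((isSmoothFamily_reebFlow n).reparam (contDiff_const.mul contDiff_id))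
  refine ⟨hs, fun t ht p => ?_⟩
  rw [hs.pathVelocity_eq_deriv ht]
  have h1 : HasDerivAt (fun s : ℝ => ((0, 0, c * s) : StdSpace n)) (0, 0, c) t := by
    refine (hasDerivAt_const t _).prodMk ((hasDerivAt_const t _).prodMk ?_)
    simpa using (hasDerivAt_id t).const_mul c
  have h2 : HasDerivAt (fun s => (F s).trans (reebFlow n (c * s)) p)
      (deriv (fun s => F s p) t + (0, 0, c)) t := (hF.smooth.hasDerivAt_curve t p).add h1
  rw [h2.deriv]
  have h3 := hF.null t p
  rw [stdContactForm_apply] at h3 ⊢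
  simp only [Diffeomorph.coe_trans, Function.comp_apply, reebFlow_apply, Prod.snd_add,
    Prod.fst_add, add_zero]
  linarith

/-- The affine diffeomorphism `(x, y, z) ↦ (x + a eᵢ, y + b eᵢ, z - b xᵢ - c)`. -/
noncomputable def planarShift {n : ℕ} (i : Fin n) (a b c : ℝ) : StdDiffeo n where
  toFun p := p + (Pi.single i a, Pi.single i b, -b * p.1 i - c)
  invFun p := p + (-Pi.single i a, -Pi.single i b, b * (p.1 i - a) + c)
  left_inv p := by
    ext j
    · simp
    · simp
    · simp
      ring
  right_inv p := by
    ext j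
    · simp
    · simp
    · simp
      ring
  contMDiff_toFun := by
    refine ContDiff.contMDiff (contDiff_id.add (contDiff_const.prodMk (contDiff_const.prodMk ?_)))
    exact (contDiff_const.mul ((contDiff_apply ℝ ℝ i).comp contDiff_fst)).sub contDiff_const
  contMDiff_invFun := by
    refine ContDiff.contMDiff (contDiff_id.add (contDiff_const.prodMk (contDiff_const.prodMk ?_)))
    exact (contDiff_const.mul (((contDiff_apply ℝ ℝ i).comp contDiff_fst).sub contDiff_const)).add
      contDiff_const

theorem planarShift_apply {n : ℕ} (i : Fin n) (a b c : ℝ) (p : StdSpace n) :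
    planarShift i a b c p = p + (Pi.single i a, Pi.single i b, -b * p.1 i - c) := rfl

/-- A curve `(a, b)` in the plane lifts to a null family, for `c = ∫ a db`. -/
theorem isNullFamily_planarShift {n : ℕ} (i : Fin n) {a b c : ℝ → ℝ} (ha : ContDiff ℝ ∞ a)
    (hb : ContDiff ℝ ∞ b) (hc : ContDiff ℝ ∞ c) (h : ∀ t, deriv c t = a t * deriv b t) :
    IsNullFamily fun t => planarShift i (a t) (b t) (c t) := by
  have hsingle : ContDiff ℝ ∞ fun s : ℝ => (Pi.single i s : Fin n → ℝ) :=
    (ContinuousLinearMap.single ℝ (fun _ : Fin n => ℝ) i).contDiff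
  refine ⟨?_, fun t p => ?_⟩
  · refine contDiff_snd.add ((hsingle.comp (ha.comp contDiff_fst)).prodMk
      ((hsingle.comp (hb.comp contDiff_fst)).prodMk ?_))
    exact ((hb.comp contDiff_fst).neg.mul
      ((contDiff_apply ℝ ℝ i).comp (contDiff_fst.comp contDiff_snd))).sub (hc.comp contDiff_fst)
  · have da : HasDerivAt a (deriv a t) t := (ha.differentiable (by simp) t).hasDerivAt
    have db : HasDerivAt b (deriv b t) t := (hb.differentiable (by simp) t).hasDerivAt
    have dc : HasDerivAt c (deriv c t) t := (hc.differentiable (by simp) t).hasDerivAt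
    have dsingle : ∀ {u : ℝ → ℝ} {u' : ℝ}, HasDerivAt u u' t →
        HasDerivAt (fun s => (Pi.single i (u s) : Fin n → ℝ)) (Pi.single i u') t := fun hu =>
      (ContinuousLinearMap.single ℝ (fun _ : Fin n => ℝ) i).hasFDerivAt.comp_hasDerivAt t hu
    have hd : HasDerivAt (fun s => planarShift i (a s) (b s) (c s) p)
        (Pi.single i (deriv a t), Pi.single i (deriv b t), -deriv b t * p.1 i - deriv c t) t :=
      ((dsingle da).prodMk ((dsingle db).prodMk
        ((db.neg.mul_const (p.1 i)).sub dc))).const_add p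
    rw [hd.deriv, stdContactForm_apply, planarShift_apply, h]
    simp [Pi.single_apply]
    ring

/-- The lift of a circle of radius `r` in a coordinate plane `(xᵢ, yᵢ)` is a null arc from the
identity to the Reeb shift by minus the area of the circle. -/
theorem exists_isNullArc_reebFlow {n : ℕ} (i : Fin n) {r : ℝ} (hr : 0 ≤ r) (hr1 : r ≤ 1) :
    ∃ a b c : ℝ → ℝ, IsNullArc (fun t => planarShift i (a t) (b t) (c t))
      (reebFlow n (-(Real.pi * r ^ 2))) ∧ ∀ t, |a t| ≤ r ∧ |b t| ≤ 2 * r ∧ |c t| ≤ 5 * r := by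
  set a : ℝ → ℝ := fun t => r * Real.sin (2 * Real.pi * t) with ha
  set b : ℝ → ℝ := fun t => r * (1 - Real.cos (2 * Real.pi * t)) with hb
  set c : ℝ → ℝ := fun t => r ^ 2 * (Real.pi * t - Real.sin (2 * Real.pi * t) *
    Real.cos (2 * Real.pi * t) / 2) with hc
  have has : ContDiff ℝ ∞ a := by fun_prop
  have hbs : ContDiff ℝ ∞ b := by fun_prop
  have hcs : ContDiff ℝ ∞ c := by fun_prop
  have hnull : IsNullFamily fun t => planarShift i (a t) (b t) (c t) := by
    refine isNullFamily_planarShift i has hbs hcs fun t => ?_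
    have h0 : HasDerivAt (fun t : ℝ => 2 * Real.pi * t) (2 * Real.pi) t := by
      simpa using (hasDerivAt_id t).const_mul (2 * Real.pi)
    have h1 : HasDerivAt (fun t : ℝ => Real.pi * t) Real.pi t := by
      simpa using (hasDerivAt_id t).const_mul Real.pi
    have hdb : HasDerivAt b _ t := (h0.cos.const_sub 1).const_mul r
    have hdc : HasDerivAt c _ t := (h1.sub ((h0.sin.mul h0.cos).div_const 2)).const_mul (r ^ 2)
    rw [hdb.deriv, hdc.deriv, ha]
    linear_combination (r ^ 2 * Real.pi) * (-Real.sin_sq_add_cos_sq (2 * Real.pi * t))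
  refine ⟨fun t => a (smoothStep t), fun t => b (smoothStep t), fun t => c (smoothStep t),
    ⟨hnull.reparam contDiff_smoothStep, fun t ht p => ?_, fun t ht p => ?_⟩, fun t => ⟨?_, ?_, ?_⟩⟩
  · simp [smoothStep_of_le ht, ha, hb, hc, planarShift_apply]
  · simp [smoothStep_of_ge ht, ha, hb, hc, planarShift_apply, reebFlow_apply]
    ring
  · rw [ha, abs_mul, abs_of_nonneg hr]
    exact mul_le_of_le_one_right hr (Real.abs_sin_le_one _)
  · have h1 := Real.neg_one_le_cos (2 * Real.pi * smoothStep t)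
    have h2 := Real.cos_le_one (2 * Real.pi * smoothStep t)
    rw [hb, abs_of_nonneg (mul_nonneg hr (by linarith)), mul_comm]
    gcongr
    linarith
  · set τ := smoothStep t
    have h1 : |Real.pi * τ| ≤ 4 := by
      rw [abs_of_nonneg (mul_nonneg Real.pi_pos.le (smoothStep_nonneg t))]
      exact (mul_le_of_le_one_right Real.pi_pos.le (smoothStep_le_one t)).trans Real.pi_le_four
    have h2 : |Real.sin (2 * Real.pi * τ) * Real.cos (2 * Real.pi * τ) / 2| ≤ 1 := by
      rw [abs_div, abs_mul, abs_two]
      have := mul_le_one₀ (Real.abs_sin_le_one (2 * Real.pi * τ)) (abs_nonneg _)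
        (Real.abs_cos_le_one (2 * Real.pi * τ))
      linarith
    have h3 := (abs_sub _ _).trans (add_le_add h1 h2)
    rw [hc, abs_mul, abs_of_nonneg (sq_nonneg r), mul_comm]
    have h4 : r ^ 2 ≤ r := by nlinarith
    norm_num at h3
    exact mul_le_mul h3 h4 (sq_nonneg r) (by norm_num)

/-- A diffeomorphism that agrees with a small affine perturbation of the identity off a closed set
is `C^r`-close to the identity there, for every `r`. -/
theorem isCloseToIdOn_of_eq_affine {n : ℕ} {K L : Set (StdSpace n)} (hK : IsClosed K)
    {T : StdSpace n →L[ℝ] StdSpace n} {v : StdSpace n} {g : StdDiffeo n}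
    (hg : ∀ p ∉ K, g p = p + (T p + v)) {ε : ℝ} (hε : 0 < ε) (hT : ‖T‖ < ε)
    (hv : ∀ p ∈ L, ‖T p + v‖ < ε) (r : ℕ) : IsCloseToIdOn r (L \ K) ε g := by
  rintro k - p ⟨hpL, hpK⟩
  have h1 : (fun q => g q - q) =ᶠ[𝓝 p] fun q => T q + v := by
    filter_upwards [hK.isOpen_compl.mem_nhds hpK] with q hq
    rw [hg q hq, add_sub_cancel_left]
  rw [(Filter.EventuallyEq.iteratedFDeriv ℝ h1 k).eq_of_nhds]
  have h2 : fderiv ℝ (fun q => T q + v) = fun _ => T := by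
    ext1 q
    rw [fderiv_add_const, T.fderiv]
  match k with
  | 0 => rw [norm_iteratedFDeriv_zero]; exact hv p hpL
  | 1 =>
    rw [← zero_add 1, ← norm_iteratedFDeriv_fderiv, h2, norm_iteratedFDeriv_zero]
    exact hT
  | k + 2 =>
    rw [← norm_iteratedFDeriv_fderiv, h2, iteratedFDeriv_const_of_ne (by simp)]
    simpa using hε

/-- The composition of a small lift of a circle with the Reeb flow is close to the identity. -/
theorem exists_isCloseToIdOn {n : ℕ} (i : Fin n) {L : Set (StdSpace n)} (hL : IsCompact L) {ε : ℝ}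
    (hε : 0 < ε) : ∃ ρ : ℝ, 0 < ρ ∧ ρ ≤ 1 ∧ ∀ a b c s : ℝ, |a| ≤ ρ → |b| ≤ 2 * ρ → |c| ≤ 5 * ρ →
      |s| ≤ 4 * ρ → ∀ (K : Set (StdSpace n)) (g : StdDiffeo n), IsClosed K →
      (∀ p ∉ K, g p = reebFlow n s (planarShift i a b c p)) →
      ∀ r, IsCloseToIdOn r (L \ K) ε g := by
  obtain ⟨M₀, hM₀⟩ := hL.isBounded.exists_norm_le
  set M := |M₀|
  have hM : ∀ p ∈ L, ‖p‖ ≤ M := fun p hp => (hM₀ p hp).trans (le_abs_self _)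
  have hM0 : 0 ≤ M := abs_nonneg _
  obtain ⟨ρ, hρ, hρ1, hρε⟩ : ∃ ρ : ℝ, 0 < ρ ∧ ρ ≤ 1 ∧ ρ * (2 * M + 9) < ε := by
    refine ⟨min 1 (ε / (2 * (2 * M + 9))), by positivity, min_le_left _ _, ?_⟩
    calc _ ≤ ε / (2 * (2 * M + 9)) * (2 * M + 9) := by gcongr; exact min_le_right _ _
      _ = ε / 2 := by field_simp
      _ < ε := by linarith
  refine ⟨ρ, hρ, hρ1, fun a b c s ha hb hc hs K g hK hg r => ?_⟩
  have hcoord : ∀ p : StdSpace n, |p.1 i| ≤ ‖p‖ := fun p =>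
    (norm_le_pi_norm p.1 i).trans (norm_fst_le p)
  set T : StdSpace n →L[ℝ] StdSpace n := -b •
    (ContinuousLinearMap.inr ℝ (Fin n → ℝ) ((Fin n → ℝ) × ℝ)).comp
      ((ContinuousLinearMap.inr ℝ (Fin n → ℝ) ℝ).comp
        ((ContinuousLinearMap.proj (R := ℝ) (φ := fun _ : Fin n => ℝ) i).comp
          (ContinuousLinearMap.fst ℝ (Fin n → ℝ) ((Fin n → ℝ) × ℝ)))) with hT
  have hTp : ∀ p, T p = (0, 0, -b * p.1 i) := fun p => by
    ext j
    · simp [hT]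
    · simp [hT]
    · simp [hT]
  have hTn : ∀ p, ‖T p‖ ≤ 2 * ρ * ‖p‖ := fun p => by
    have h1 : |b * p.1 i| ≤ 2 * ρ * ‖p‖ := by
      rw [abs_mul]
      exact mul_le_mul hb (hcoord p) (abs_nonneg _) (by positivity)
    have h0 : 0 ≤ 2 * ρ * ‖p‖ := by positivity
    simp only [hTp, Prod.norm_mk, norm_zero, Real.norm_eq_abs, neg_mul, abs_neg]
    exact max_le h0 (max_le h0 h1)
  have hMρ : 0 ≤ ρ * M := by positivity
  refine isCloseToIdOn_of_eq_affine hK (T := T)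
    (v := (Pi.single i a, Pi.single i b, s - c)) (fun p hp => ?_) hε
    ((T.opNorm_le_bound (by positivity) hTn).trans_lt (by linarith)) (fun p hp => ?_) r
  · rw [hg p hp, reebFlow_apply, planarShift_apply, hTp]
    ext j
    · simp
    · simp
    · simp
      ring
  · have h1 : ‖((Pi.single i a, Pi.single i b, s - c) : StdSpace n)‖ ≤ 9 * ρ := by
      simp only [Prod.norm_mk, Pi.norm_single, Real.norm_eq_abs]
      refine max_le (by linarith) (max_le (by linarith) ?_)
      exact (abs_sub s c).trans (by linarith)
    calc _ ≤ 2 * ρ * ‖p‖ + 9 * ρ := (norm_add_le _ _).trans (add_le_add (hTn p) h1)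
      _ ≤ 2 * ρ * M + 9 * ρ := by gcongr; exact hM p hp
      _ = ρ * (2 * M + 9) := by ring
      _ < ε := hρε

/-! ### Null and positive paths to a given diffeomorphism -/

theorem mainTheorem1 (n : ℕ) (hn : 1 ≤ n) (f : StdDiffeo n) :
    (f ∈ diffZero n →
      (∃ F : ℝ → StdDiffeo n, IsDiffeoPathTo F f ∧ IsNullPath F) ∧
      (∃ F : ℝ → StdDiffeo n, IsDiffeoPathTo F f ∧ IsPositivePath F)) ∧
    ((∃ F : ℝ → StdDiffeo n, IsDiffeoPathTo F f ∧ IsCompactlySupportedPath F) →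
      (∃ F : ℝ → StdDiffeo n, IsDiffeoPathTo F f ∧ IsCompactlySupportedPath F ∧ IsNullPath F) ∧
      (∃ K : Set (StdSpace n), IsCompact K ∧
        ∀ (r : ℕ) (L : Set (StdSpace n)) (ε : ℝ), IsCompact L → 0 < ε →
          ∃ F : ℝ → StdDiffeo n, IsDiffeoPathTo F f ∧ IsPositivePath F ∧
            ∀ t ∈ Icc (0 : ℝ) 1, IsCloseToIdOn r (L \ K) ε (F t))) := by
  refine ⟨?_, ?_⟩
  · rintro ⟨F, hF⟩
    have hf : IsotopicToIdRel ∅ f := hF.isotopicToIdRel fun t _ p hp => hp.elim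
    refine ⟨?_, ?_⟩
    · obtain ⟨H, hH, h0, h1⟩ := hf.exists_nullFamily hn
      exact ⟨H, hH.smooth.isDiffeoPathTo (h0 0 le_rfl) (h1 1 le_rfl), hH.isNullPath⟩
    · -- the Reeb flow applied to a null path from the identity to `f` shifted back by the Reeb flow
      have hshift : IsotopicToIdRel ∅ (reebFlow n (-1)) :=
        ⟨fun t => reebFlow n (-t), (isSmoothFamily_reebFlow n).reparam contDiff_neg,
          fun p => by simp [reebFlow_apply], fun p => rfl, fun t p hp => hp.elim⟩
      obtain ⟨H, hH, h0, h1⟩ := (hf.trans hshift).exists_nullFamily hn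
      obtain ⟨hs, hpos⟩ := hH.isPositivePath_trans_reebFlow one_pos
      refine ⟨_, hs.isDiffeoPathTo (fun p => ?_) (fun p => ?_), hpos⟩
      · simp [h0 0 le_rfl, reebFlow_apply]
      · simp [h1 1 le_rfl, reebFlow_apply, add_assoc]
  · rintro ⟨F, hF, K₀, hK₀, hFK₀⟩
    have hf : NullReachable univ f := by
      obtain ⟨G, hG, hG0, hG1, hGK⟩ := hF.isotopicToIdRel (S := K₀ᶜ) hFK₀
      rw [← show G 1 = f from Diffeomorph.ext hG1]
      exact nullReachable_of_isotopy hn hK₀ isOpen_univ (subset_univ _) hG hGK hG0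
    obtain ⟨H, K, hH, hK, -, hHK⟩ := hf
    refine ⟨⟨H, hH.smooth.isDiffeoPathTo (hH.start 0 (by norm_num)) (hH.finish 1 (by norm_num)),
      ⟨K, hK, fun t _ => hHK t⟩, hH.isNullPath⟩, K, hK, fun r L ε hL hε => ?_⟩
    -- off `K`, only the small null arc from the identity to the Reeb flow for the negative time
    -- `-π ρ²` and the compensating Reeb flow are seen
    let i : Fin n := ⟨0, hn⟩
    obtain ⟨ρ, hρ, hρ1, hclose⟩ := exists_isCloseToIdOn i hL hε
    obtain ⟨a, b, c, harc, hbound⟩ := exists_isNullArc_reebFlow i hρ.le hρ1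
    have hconcat := hH.trans harc
    have hpi : 0 < Real.pi * ρ ^ 2 := by positivity
    obtain ⟨hs, hpos⟩ := hconcat.isPositivePath_trans_reebFlow hpi
    refine ⟨_, hs.isDiffeoPathTo (fun p => ?_) (fun p => ?_), hpos, fun t ht => ?_⟩
    · have := hconcat.start 0 (by norm_num) p
      rw [Diffeomorph.coe_trans, Function.comp_apply, this]
      simp [reebFlow_apply]
    · have := hconcat.finish 1 (by norm_num) p
      rw [Diffeomorph.coe_trans, Function.comp_apply, this]
      simp [reebFlow_apply, add_assoc]
    · obtain ⟨h1, h2, h3⟩ := hbound (4 * t - 2)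
      refine hclose _ _ _ (Real.pi * ρ ^ 2 * t) h1 h2 h3 ?_ K _ hK.isClosed (fun p hp => ?_) r
      · rw [abs_of_nonneg (mul_nonneg hpi.le ht.1)]
        calc Real.pi * ρ ^ 2 * t ≤ 4 * ρ * 1 := by
              have h4 : ρ ^ 2 ≤ ρ := by nlinarith
              exact mul_le_mul (mul_le_mul Real.pi_le_four h4 (sq_nonneg ρ) (by norm_num)) ht.2
                ht.1 (by positivity)
          _ = 4 * ρ := mul_one _
      · simp [hHK _ p hp]
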